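/- Let $A$ and $B$ be (possibly unbounded) self-adjoint operators in a complex Hilbert space $\mathcal H$, let $K$ be a bounded operator in $\mathcal H$, and let $z\in\mathbb C$ belong to the resolvent sets of both $A$ and $B$. Let $E_\lambda$ denote the spectral projections of $B$, let $P_{ac}(B)$ be the orthogonal projection onto the absolutely continuous subspace of $B$ (the closed subspace of all $\varphi$ for which the measure $d(\varphi,E_\lambda\varphi)$ is absolutely continuous with respect to Lebesgue measure), and let $\mathcal M(B)$ be the set of all $\varphi\in\mathcal H$ such that $d(\varphi,E_\lambda\varphi)=|f(\lambda)|^2\,d\lambda$ for some $f\in L^\infty(\mathbb R)$. Suppose that $$K(B-z)^{-1}-(A-z)^{-1}K=C_1+C_2,$$ where $C_1$ is a trace class operator and $C_2$ is a bounded operator in $\mathcal H$. Suppose further that there is a subset $M\subset\mathcal M(B)$, dense in $\mathcal M(B)$ in the norm of $\mathcal H$, such that for every $\varphi\in M$ $$\lim_{t\to+\infty}C_2e^{-iBt}\varphi=0\quad\text{and}\quad\int_0^{+\infty}\|C_2e^{-iBt}\varphi\|\,dt<\infty.$$ Then the strong limit $$\Omega_{out}(A,B;K)=\operatorname*{s-lim}_{t\to+\infty}e^{iAt}Ke^{-iBt}P_{ac}(B)$$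 exists; that is, there is a bounded operator $\Omega_{out}(A,B;K)$ in $\mathcal H$ such that $e^{iAt}Ke^{-iBt}P_{ac}(B)\varphi\to\Omega_{out}(A,B;K)\varphi$ in norm as $t\to+\infty$ for every $\varphi\in\mathcal H$. -/

import Mathlib

open MeasureTheory Filter Topology
open scoped ENNReal InnerProductSpace

noncomputable section

namespace Scattering

variable {H : Type*} [NormedAddCommGroup H] [InnerProductSpace ℂ H] [CompleteSpace H]

/-! ### Resolvents of unbounded operators -/

/-- `R` is the bounded everywhere defined two-sided inverse of `A - z : D(A) → H`. -/
def IsResolventAt (A : H →ₗ.[ℂ] H) (z : ℂ) (R : H →L[ℂ] H) : Prop :=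
  (∀ ψ : H, ∃ h : R ψ ∈ A.domain, A ⟨R ψ, h⟩ - z • R ψ = ψ) ∧
    ∀ φ : A.domain, R (A φ - z • (φ : H)) = φ

/-- The resolvent set of an unbounded operator. -/
def resolventSet (A : H →ₗ.[ℂ] H) : Set ℂ := {z | ∃ R : H →L[ℂ] H, IsResolventAt A z R}

open Classical in
/-- The resolvent `(A - z)⁻¹`, for `z` in the resolvent set (and `0` elsewhere). -/
def resolvent (A : H →ₗ.[ℂ] H) (z : ℂ) : H →L[ℂ] H :=
  if h : ∃ R : H →L[ℂ] H, IsResolventAt A z R then h.choose else 0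

/-! ### Trace class operators -/

/-- `T` is trace class: `Tr |T| = ∑ ⟨e, |T| e⟩ < ∞`, where `|T| = (T⋆ T)^{1/2}` and `e` runs through
an orthonormal basis. (The value of the sum does not depend on the basis.) -/
def IsTraceClass (T : H →L[ℂ] H) : Prop :=
  ∃ (s : Set H) (b : HilbertBasis s ℂ H), Summable fun i => (⟪b i, CFC.abs T (b i)⟫_ℂ).re

/-! ### Projection-valued measures on the real line -/

/-- Projection-valued measures on the Borel sets of `ℝ`; values on non-Borel sets are irrelevant. -/
structure ProjectionValuedMeasure (H : Type*) [NormedAddCommGroup H] [InnerProductSpace ℂ H]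
    [CompleteSpace H] where
  proj : Set ℝ → H →L[ℂ] H
  isStarProjection : ∀ S, MeasurableSet S → IsStarProjection (proj S)
  proj_univ : proj Set.univ = 1
  proj_inter : ∀ S T, MeasurableSet S → MeasurableSet T → proj (S ∩ T) = proj S * proj T
  hasSum_proj : ∀ S : ℕ → Set ℝ, (∀ n, MeasurableSet (S n)) →
    Pairwise (Function.onFun Disjoint S) →
    ∀ φ : H, HasSum (fun n => proj (S n) φ) (proj (⋃ n, S n) φ)

namespace ProjectionValuedMeasure

open Classical in
/-- The projection-valued measure concentrated at the point `0`. -/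
instance : Inhabited (ProjectionValuedMeasure H) where
  default :=
    { proj := fun S => if (0 : ℝ) ∈ S then 1 else 0
      isStarProjection := fun S _ => by
        by_cases h : (0 : ℝ) ∈ S
        · simp [h]
        · simp [h]
      proj_univ := by simp
      proj_inter := fun S T _ _ => by
        by_cases h : (0 : ℝ) ∈ S <;> by_cases h' : (0 : ℝ) ∈ T <;> simp [h, h']
      hasSum_proj := fun S _ hd φ => by
        by_cases h : ∃ n, (0 : ℝ) ∈ S n
        · obtain ⟨n, hn⟩ := h
          have h1 : (0 : ℝ) ∈ ⋃ n, S n := Set.mem_iUnion.2 ⟨n, hn⟩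
          have h2 := hasSum_single (f := fun n => (if (0 : ℝ) ∈ S n then (1 : H →L[ℂ] H) else 0) φ) n
            (fun m hm => by
              have : (0 : ℝ) ∉ S m := fun h' => Set.disjoint_left.1 (hd hm) h' hn
              simp [this])
          simpa [h1, hn] using h2
        · have h1 : (0 : ℝ) ∉ ⋃ n, S n := by simpa using h
          push Not at h
          simp [h1, h] }

variable (E : ProjectionValuedMeasure H)

theorem re_inner_proj {S : Set ℝ} (hS : MeasurableSet S) (φ : H) :
    (⟪φ, E.proj S φ⟫_ℂ).re = ‖E.proj S φ‖ ^ 2 := by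
  have h := E.isStarProjection S hS
  have h1 : E.proj S (E.proj S φ) = E.proj S φ := by
    rw [← mul_apply_eq_comp, h.isIdempotentElem.eq]
  have h2 : ⟪φ, E.proj S (E.proj S φ)⟫_ℂ = ⟪E.proj S φ, E.proj S φ⟫_ℂ := by
    rw [← ContinuousLinearMap.adjoint_inner_left, ← ContinuousLinearMap.star_eq_adjoint,
      h.isSelfAdjoint.star_eq]
  rw [h1] at h2
  rw [h2, inner_self_eq_norm_sq_to_K]
  norm_cast

theorem proj_empty : E.proj ∅ = 0 := by
  ext φ
  have h := E.hasSum_proj (fun _ => ∅) (fun _ => MeasurableSet.empty)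
    (fun _ _ _ => by simp [Function.onFun]) φ
  simpa using h.summable.tendsto_atTop_zero

/-- The scalar spectral measure `μ_φ(S) = ⟨φ, E(S) φ⟩`, i.e. `d(φ, E_λ φ)`. -/
def scalarMeasure (φ : H) : Measure ℝ :=
  Measure.ofMeasurable (fun S _ => ENNReal.ofReal (⟪φ, E.proj S φ⟫_ℂ).re)
    (by simp [proj_empty])
    (fun S hS hd => by
      have h := (((innerSL ℂ φ).hasSum (E.hasSum_proj S hS hd φ)).mapL Complex.reCLM)
      simp only [innerSL_apply_apply, Complex.reCLM_apply] at h
      rw [← h.tsum_eq, ENNReal.ofReal_tsum_of_nonneg _ h.summable]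
      intro n
      rw [E.re_inner_proj (hS n)]
      positivity)

theorem scalarMeasure_apply (φ : H) {S : Set ℝ} (hS : MeasurableSet S) :
    E.scalarMeasure φ S = ENNReal.ofReal (⟪φ, E.proj S φ⟫_ℂ).re :=
  Measure.ofMeasurable_apply S hS

theorem scalarMeasure_eq_zero_iff (φ : H) {S : Set ℝ} (hS : MeasurableSet S) :
    E.scalarMeasure φ S = 0 ↔ E.proj S φ = 0 := by
  rw [scalarMeasure_apply E φ hS, E.re_inner_proj hS, ENNReal.ofReal_eq_zero]
  constructor
  · intro h
    exact norm_eq_zero.1 (pow_eq_zero_iff two_ne_zero |>.1 (le_antisymm h (by positivity)))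
  · intro h
    simp [h]

theorem absolutelyContinuous_iff (φ : H) :
    E.scalarMeasure φ ≪ volume ↔
      ∀ S : Set ℝ, MeasurableSet S → volume S = 0 → E.proj S φ = 0 := by
  constructor
  · intro h S hS h0
    exact (E.scalarMeasure_eq_zero_iff φ hS).1 (h h0)
  · intro h
    exact Measure.AbsolutelyContinuous.mk fun S hS h0 =>
      (E.scalarMeasure_eq_zero_iff φ hS).2 (h S hS h0)

/-- The absolutely continuous subspace: all `φ` whose scalar spectral measure is absolutely
continuous with respect to the Lebesgue measure. -/
def acSubspace : Submodule ℂ H where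
  carrier := {φ | E.scalarMeasure φ ≪ volume}
  zero_mem' := (E.absolutelyContinuous_iff 0).2 fun S _ _ => map_zero _
  add_mem' := fun {φ ψ} hφ hψ => (E.absolutelyContinuous_iff _).2 fun S hS h0 => by
    rw [map_add, (E.absolutelyContinuous_iff φ).1 hφ S hS h0,
      (E.absolutelyContinuous_iff ψ).1 hψ S hS h0, add_zero]
  smul_mem' := fun c φ hφ => (E.absolutelyContinuous_iff _).2 fun S hS h0 => by
    rw [map_smul, (E.absolutelyContinuous_iff φ).1 hφ S hS h0, smul_zero]

theorem isClosed_acSubspace : IsClosed (E.acSubspace : Set H) := by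
  have : (E.acSubspace : Set H) =
      ⋂ (S : Set ℝ) (_ : MeasurableSet S) (_ : volume S = 0), {φ | E.proj S φ = 0} := by
    ext φ
    simp only [Set.mem_iInter]
    exact E.absolutelyContinuous_iff φ
  rw [this]
  exact isClosed_iInter fun S => isClosed_iInter fun _ => isClosed_iInter fun _ =>
    isClosed_eq (E.proj S).continuous continuous_const

instance : CompleteSpace E.acSubspace := E.isClosed_acSubspace.completeSpace_coe

/-- The orthogonal projection onto the absolutely continuous subspace. -/
def acProj : H →L[ℂ] H := E.acSubspace.starProjection

open Classical in
/-- The spectral integral `∫ f(λ) dE_λ` of a bounded Borel function `f`: the unique bounded operator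
`T` with `⟨φ, T φ⟩ = ∫ f(λ) d(φ, E_λ φ)` for all `φ`. (It exists for every bounded Borel `f`; where
there is no such operator the value is `0`.) -/
def integral (f : ℝ → ℂ) : H →L[ℂ] H :=
  if h : ∃ T : H →L[ℂ] H, ∀ φ : H, ⟪φ, T φ⟫_ℂ = ∫ x, f x ∂(E.scalarMeasure φ)
  then h.choose else 0

end ProjectionValuedMeasure

/-! ### The spectral measure of a self-adjoint operator -/

/-- `B = ∫ λ dE_λ`: the domain of `B` consists of all `φ` with `∫ λ² d(φ, E_λ φ) < ∞`, and
`⟨φ, B φ⟩ = ∫ λ d(φ, E_λ φ)` there. -/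
def IsSpectralMeasure (B : H →ₗ.[ℂ] H) (E : ProjectionValuedMeasure H) : Prop :=
  (∀ φ : H, φ ∈ B.domain ↔ ∫⁻ x, ENNReal.ofReal (x ^ 2) ∂(E.scalarMeasure φ) < ∞) ∧
    ∀ φ : B.domain, ⟪(φ : H), B φ⟫_ℂ = ∫ x, (x : ℂ) ∂(E.scalarMeasure (φ : H))

open Classical in
/-- The spectral measure `E` of `B`; by the spectral theorem every self-adjoint operator has exactly
one. (The value for operators that have none is irrelevant.) -/
def spectralMeasure (B : H →ₗ.[ℂ] H) : ProjectionValuedMeasure H :=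
  if h : ∃ E : ProjectionValuedMeasure H, IsSpectralMeasure B E then h.choose else default

/-- The unitary group `e^{iBt} = ∫ e^{iλt} dE_λ` of a self-adjoint operator `B`. -/
def expI (B : H →ₗ.[ℂ] H) (t : ℝ) : H →L[ℂ] H :=
  (spectralMeasure B).integral fun x => Complex.exp (Complex.I * x * t)

/-- `P_ac(B)`, the projection onto the absolutely continuous subspace of `B`. -/
def Pac (B : H →ₗ.[ℂ] H) : H →L[ℂ] H := (spectralMeasure B).acProj

/-- The set `𝓜(B)` of all `φ` with `d(φ, E_λ φ) = |f(λ)|² dλ` for some `f ∈ L^∞(ℝ)`. -/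
def boundedDensitySet (B : H →ₗ.[ℂ] H) : Set H :=
  {φ | ∃ f : ℝ → ℂ, MemLp f ∞ volume ∧
    (spectralMeasure B).scalarMeasure φ = volume.withDensity fun x => ‖f x‖ₑ ^ 2}

end Scattering

end

/-!
The idea is Pearson's trace class method. The derivative of `e^{iAt} K e^{-iBt} φ` involves `A` and
`B` themselves, so one first replaces `K` by `J = (A - z)⁻¹ K (B - z)⁻¹`, for which
`y(t) = e^{iAt} J e^{-iBt} φ` has derivative `i e^{iAt} (C₁ + C₂) e^{-iBt} φ`. If `φ ∈ 𝓜(B)` and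
`C₁ = G S†` with Hilbert–Schmidt operators `G`, `S`, the Plancherel theorem bounds
`∫ ‖T† e^{-iBt} φ‖² dt` by the Hilbert–Schmidt norm of `T`, for `T = S` and for
`T = J† e^{-iAτ} G`, uniformly in `τ`. Therefore `⟨y(s), y'(t)⟩` splits into a product of square
integrable functions and an integrable one. Integrating the derivative of `‖y(t + a) - y(s + a)‖²`
over `a > 0` shows that `y` is Cauchy at infinity; the boundary term at infinity vanishes because
`y' → 0` there, by the Riemann–Lebesgue lemma.

Since all approximants are uniformly bounded, the limit exists on the whole absolutely continuous
subspace. There `(C₁ + C₂) e^{-iBt} φ → 0`, hence `(A - z)⁻¹ K (B - z)⁻¹` may be replaced by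
`K (B - z)⁻²`, and `(B - z)⁻²` has dense range in the absolutely continuous subspace.

The spectral theorem is obtained from the resolvent: it is a bounded normal operator, so the
continuous functional calculus and the Riesz–Markov–Kakutani theorem give its scalar spectral
measures, which `y ↦ y⁻¹ + z` carries to the real line.
-/

open scoped NNReal ContinuousMap FourierTransform

noncomputable section

namespace Scattering

/-! ### Quadratic forms and weak limits of bounded operators -/

section QuadraticForm

variable {H V : Type*} [NormedAddCommGroup H] [InnerProductSpace ℂ H] [AddCommGroup V] [Module ℂ V]

theorem inner_map_map_polarization (S T : V →ₗ[ℂ] H) (x y : V) :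
    ⟪S x, T y⟫_ℂ = (⟪S (x + y), T (x + y)⟫_ℂ - ⟪S (x - y), T (x - y)⟫_ℂ
      - Complex.I * ⟪S (x + Complex.I • y), T (x + Complex.I • y)⟫_ℂ
      + Complex.I * ⟪S (x - Complex.I • y), T (x - Complex.I • y)⟫_ℂ) / 4 := by
  simp only [map_add, map_sub, map_smul, inner_add_left, inner_add_right, inner_sub_left,
    inner_sub_right, inner_smul_left, inner_smul_right, Complex.conj_I]
  linear_combination (⟪S x, T y⟫_ℂ - ⟪S y, T x⟫_ℂ) / 2 * Complex.I_sq

theorem tendsto_inner_map_of_forall_self {ι : Type*} {l : Filter ι} {S : V →ₗ[ℂ] H}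
    {T : ι → V →ₗ[ℂ] H} {q : V → ℂ} (h : ∀ x, Tendsto (fun i => ⟪S x, T i x⟫_ℂ) l (𝓝 (q x)))
    (x y : V) :
    Tendsto (fun i => ⟪S x, T i y⟫_ℂ) l (𝓝 ((q (x + y) - q (x - y)
      - Complex.I * q (x + Complex.I • y) + Complex.I * q (x - Complex.I • y)) / 4)) := by
  simp_rw [fun i => inner_map_map_polarization S (T i) x y]
  exact (((((h _).sub (h _)).sub ((h _).const_mul _)).add ((h _).const_mul _)).div_const _)

theorem tendsto_inner_map_inner_map_of_forall_self {ι : Type*} {l : Filter ι} {S : V →ₗ[ℂ] H}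
    {T : ι → V →ₗ[ℂ] H} {T₀ : V →ₗ[ℂ] H}
    (h : ∀ x, Tendsto (fun i => ⟪S x, T i x⟫_ℂ) l (𝓝 ⟪S x, T₀ x⟫_ℂ)) (x y : V) :
    Tendsto (fun i => ⟪S x, T i y⟫_ℂ) l (𝓝 ⟪S x, T₀ y⟫_ℂ) := by
  rw [inner_map_map_polarization]
  exact tendsto_inner_map_of_forall_self (q := fun x => ⟪S x, T₀ x⟫_ℂ) h x y

theorem norm_inner_map_le_of_forall_self {T : H →ₗ[ℂ] H} {c : ℝ}
    (h : ∀ x, ‖⟪x, T x⟫_ℂ‖ ≤ c * ‖x‖ ^ 2) (x y : H) :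
    ‖⟪x, T y⟫_ℂ‖ ≤ c * (‖x‖ ^ 2 + ‖y‖ ^ 2) := by
  set Q : H → ℂ := fun x => ⟪x, T x⟫_ℂ
  have polarization : 4 * ⟪x, T y⟫_ℂ = Q (x + y) - Q (x - y)
      - Complex.I * Q (x + Complex.I • y) + Complex.I * Q (x - Complex.I • y) := by
    linear_combination 4 * inner_map_map_polarization LinearMap.id T x y
  have triangle : 4 * ‖⟪x, T y⟫_ℂ‖ ≤ ‖Q (x + y)‖ + ‖Q (x - y)‖
      + ‖Q (x + Complex.I • y)‖ + ‖Q (x - Complex.I • y)‖ := by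
    calc 4 * ‖⟪x, T y⟫_ℂ‖ = ‖4 * ⟪x, T y⟫_ℂ‖ := by simp
      _ ≤ ‖Q (x + y)‖ + ‖Q (x - y)‖ + ‖Complex.I * Q (x + Complex.I • y)‖
          + ‖Complex.I * Q (x - Complex.I • y)‖ := by
        rw [polarization]
        exact (norm_add_le _ _).trans (add_le_add_left
          ((norm_sub_le _ _).trans (add_le_add_left (norm_sub_le _ _) _)) _)
      _ = _ := by simp
  have parallelogram := parallelogram_law_with_norm ℂ x y
  have parallelogram_I := parallelogram_law_with_norm ℂ x (Complex.I • y)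
  rw [norm_smul, Complex.norm_I, one_mul] at parallelogram_I
  have bound : ‖Q (x + y)‖ + ‖Q (x - y)‖ + ‖Q (x + Complex.I • y)‖ + ‖Q (x - Complex.I • y)‖
      ≤ c * ((‖x + y‖ ^ 2 + ‖x - y‖ ^ 2) +
        (‖x + Complex.I • y‖ ^ 2 + ‖x - Complex.I • y‖ ^ 2)) := by
    linarith [h (x + y), h (x - y), h (x + Complex.I • y), h (x - Complex.I • y)]
  rw [parallelogram, parallelogram_I] at bound
  linarith

theorem opNorm_le_two_mul_of_norm_inner_self_le {T : H →L[ℂ] H} {c : ℝ}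
    (h : ∀ x, ‖⟪x, T x⟫_ℂ‖ ≤ c * ‖x‖ ^ 2) (hc : 0 ≤ c) : ‖T‖ ≤ 2 * c := by
  refine ContinuousLinearMap.opNorm_le_of_re_inner_le (by positivity) fun x y hx hy => ?_
  calc RCLike.re ⟪T x, y⟫_ℂ ≤ ‖⟪T x, y⟫_ℂ‖ := RCLike.re_le_norm _
    _ = ‖⟪y, T x⟫_ℂ‖ := norm_inner_symm _ _
    _ ≤ c * (‖y‖ ^ 2 + ‖x‖ ^ 2) := norm_inner_map_le_of_forall_self (T := (T : H →ₗ[ℂ] H)) h y x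
    _ = 2 * c := by rw [hx, hy]; ring

variable {ι : Type*} {l : Filter ι} {T : ι → H →L[ℂ] H} {c : ℝ}

/-- The form `(φ, ψ) ↦ lim ⟪T i φ, ψ⟫` of a weak limit of bounded operators. -/
def weakLimitForm {L : H → H → ℂ} [l.NeBot] (hT : ∀ i, ‖T i‖ ≤ c)
    (hL : ∀ φ ψ, Tendsto (fun i => ⟪T i φ, ψ⟫_ℂ) l (𝓝 (L φ ψ))) : H →L⋆[ℂ] H →L[ℂ] ℂ :=
  (LinearMap.mk₂'ₛₗ (starRingEnd ℂ) (RingHom.id ℂ) L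
    (fun φ φ' ψ => tendsto_nhds_unique (hL _ _) (by
      simpa only [map_add, inner_add_left] using (hL φ ψ).add (hL φ' ψ)))
    (fun a φ ψ => tendsto_nhds_unique (hL _ _) (by
      simpa only [map_smul, inner_smul_left, smul_eq_mul] using
        (hL φ ψ).const_mul (starRingEnd ℂ a)))
    (fun φ ψ ψ' => tendsto_nhds_unique (hL _ _) (by
      simpa only [inner_add_right] using (hL φ ψ).add (hL φ ψ')))
    (fun a φ ψ => tendsto_nhds_unique (hL _ _) (by
      simpa only [inner_smul_right, smul_eq_mul, RingHom.id_apply] using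
        (hL φ ψ).const_mul a))).mkContinuous₂ c
    fun φ ψ => le_of_tendsto (hL φ ψ).norm (Eventually.of_forall fun i =>
      (norm_inner_le_norm _ _).trans
        (mul_le_mul_of_nonneg_right ((T i).le_of_opNorm_le (hT i) φ) (norm_nonneg ψ)))

theorem exists_forall_tendsto_inner_apply [CompleteSpace H] [l.NeBot] (hT : ∀ i, ‖T i‖ ≤ c)
    {q : H → ℂ} (hq : ∀ φ, Tendsto (fun i => ⟪φ, T i φ⟫_ℂ) l (𝓝 (q φ))) :
    ∃ T₀ : H →L[ℂ] H, ∀ ψ φ, Tendsto (fun i => ⟪ψ, T i φ⟫_ℂ) l (𝓝 ⟪ψ, T₀ φ⟫_ℂ) := by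
  have h : ∀ φ ψ, ∃ a, Tendsto (fun i => ⟪T i φ, ψ⟫_ℂ) l (𝓝 a) := fun φ ψ => by
    refine ⟨_, (Complex.continuous_conj.continuousAt.tendsto.comp
      (tendsto_inner_map_of_forall_self (S := LinearMap.id) (T := fun i => (T i : H →ₗ[ℂ] H))
        hq ψ φ)).congr fun i => ?_⟩
    exact inner_conj_symm _ _
  choose L hL using h
  refine ⟨InnerProductSpace.continuousLinearMapOfBilin (weakLimitForm hT hL), fun ψ φ => ?_⟩
  have limit_eq : ⟪ψ, InnerProductSpace.continuousLinearMapOfBilin (weakLimitForm hT hL) φ⟫_ℂ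
      = starRingEnd ℂ (L φ ψ) := by
    rw [← inner_conj_symm, InnerProductSpace.continuousLinearMapOfBilin_apply]
    rfl
  rw [limit_eq]
  exact ((Complex.continuous_conj.tendsto _).comp (hL φ ψ)).congr fun i => inner_conj_symm _ _

end QuadraticForm

/-! ### Bounded measurable functions -/

section BoundedMeasurable

variable {X : Type*} [MeasurableSpace X] {f g : X → ℂ} {P : (X → ℂ) → Prop}

/-- Bounded measurable complex functions. -/
structure IsBddMeasurable (f : X → ℂ) : Prop where
  measurable : Measurable f
  bounded : ∃ c : ℝ, ∀ x, ‖f x‖ ≤ c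

namespace IsBddMeasurable

theorem const (a : ℂ) : IsBddMeasurable (fun _ : X => a) := ⟨measurable_const, ‖a‖, fun _ => le_rfl⟩

theorem add (hf : IsBddMeasurable f) (hg : IsBddMeasurable g) :
    IsBddMeasurable (fun x => f x + g x) := by
  obtain ⟨c, hc⟩ := hf.bounded
  obtain ⟨d, hd⟩ := hg.bounded
  exact ⟨hf.measurable.add hg.measurable, c + d, fun x =>
    (norm_add_le _ _).trans (add_le_add (hc x) (hd x))⟩

theorem mul (hf : IsBddMeasurable f) (hg : IsBddMeasurable g) :
    IsBddMeasurable (fun x => f x * g x) := by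
  obtain ⟨c, hc⟩ := hf.bounded
  obtain ⟨d, hd⟩ := hg.bounded
  refine ⟨hf.measurable.mul hg.measurable, c * d, fun x => ?_⟩
  rw [norm_mul]
  exact mul_le_mul (hc x) (hd x) (norm_nonneg _) ((norm_nonneg _).trans (hc x))

theorem sub (hf : IsBddMeasurable f) (hg : IsBddMeasurable g) :
    IsBddMeasurable (fun x => f x - g x) := by
  simpa only [neg_one_mul, ← sub_eq_add_neg] using hf.add ((const (-1)).mul hg)

theorem conj (hf : IsBddMeasurable f) : IsBddMeasurable (fun x => starRingEnd ℂ (f x)) := by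
  obtain ⟨c, hc⟩ := hf.bounded
  exact ⟨Complex.continuous_conj.measurable.comp hf.measurable, c, fun x => by
    simpa only [RCLike.norm_conj] using hc x⟩

theorem indicator (hf : IsBddMeasurable f) {s : Set X} (hs : MeasurableSet s) :
    IsBddMeasurable (s.indicator f) := by
  obtain ⟨c, hc⟩ := hf.bounded
  exact ⟨hf.measurable.indicator hs, c, fun x => (norm_indicator_le_norm_self _ _).trans (hc x)⟩

theorem sum {ι : Type*} {F : ι → X → ℂ} (hF : ∀ i, IsBddMeasurable (F i)) (s : Finset ι) :
    IsBddMeasurable (fun x => ∑ i ∈ s, F i x) := by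
  classical
  induction s using Finset.induction_on with
  | empty => simpa using const 0
  | insert i s hi ih => simpa only [Finset.sum_insert hi] using (hF i).add ih

theorem of_continuousMap {Y : Type*} [TopologicalSpace Y] [CompactSpace Y] [MeasurableSpace Y]
    [OpensMeasurableSpace Y] (f : C(Y, ℂ)) : IsBddMeasurable f :=
  ⟨f.continuous.measurable, ‖f‖, f.norm_coe_le_norm⟩

theorem integrable (hf : IsBddMeasurable f) (ν : Measure X) [IsFiniteMeasure ν] :
    Integrable f ν := by
  obtain ⟨c, hc⟩ := hf.bounded
  exact Integrable.of_bound hf.measurable.aestronglyMeasurable c (Eventually.of_forall hc)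

end IsBddMeasurable

/-- Pointwise convergence of a uniformly bounded family of measurable functions, under which
integrals against every finite measure converge. -/
structure BoundedlyTendsto {ι : Type*} (F : ι → X → ℂ) (l : Filter ι) (f : X → ℂ) : Prop where
  measurable : ∀ i, Measurable (F i)
  bounded : ∃ c : ℝ, ∀ i x, ‖F i x‖ ≤ c
  tendsto : ∀ x, Tendsto (fun i => F i x) l (𝓝 (f x))

namespace BoundedlyTendsto

variable {ι : Type*} {F : ι → X → ℂ} {l : Filter ι}

theorem comp {κ : Type*} {k : Filter κ} {u : κ → ι} (h : BoundedlyTendsto F l f)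
    (hu : Tendsto u k l) : BoundedlyTendsto (fun j => F (u j)) k f :=
  ⟨fun j => h.measurable (u j), h.bounded.imp fun _ hc j => hc (u j),
    fun x => (h.tendsto x).comp hu⟩

theorem isBddMeasurable (h : BoundedlyTendsto F l f) (i : ι) : IsBddMeasurable (F i) :=
  ⟨h.measurable i, h.bounded.imp fun _ hc => hc i⟩

theorem isBddMeasurable_limit [l.NeBot] [l.IsCountablyGenerated] (h : BoundedlyTendsto F l f) :
    IsBddMeasurable f :=
  ⟨measurable_of_tendsto_metrizable' l h.measurable (tendsto_pi_nhds.2 h.tendsto),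
    h.bounded.imp fun _ hc x =>
      le_of_tendsto (h.tendsto x).norm (Eventually.of_forall fun i => hc i x)⟩

theorem mul_right (h : BoundedlyTendsto F l f) (hg : IsBddMeasurable g) :
    BoundedlyTendsto (fun i x => F i x * g x) l (fun x => f x * g x) := by
  obtain ⟨c, hc⟩ := h.bounded
  obtain ⟨d, hd⟩ := hg.bounded
  refine ⟨fun i => (h.measurable i).mul hg.measurable, ⟨c * d, fun i x => ?_⟩,
    fun x => (h.tendsto x).mul_const _⟩
  rw [norm_mul]
  exact mul_le_mul (hc i x) (hd x) (norm_nonneg _) ((norm_nonneg _).trans (hc i x))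

theorem tendsto_integral [l.IsCountablyGenerated] (h : BoundedlyTendsto F l f) (ν : Measure X)
    [IsFiniteMeasure ν] : Tendsto (fun i => ∫ x, F i x ∂ν) l (𝓝 (∫ x, f x ∂ν)) := by
  obtain ⟨c, hc⟩ := h.bounded
  exact tendsto_integral_filter_of_dominated_convergence (fun _ => c)
    (Eventually.of_forall fun i => (h.measurable i).aestronglyMeasurable)
    (Eventually.of_forall fun i => Eventually.of_forall (hc i)) (integrable_const c)
    (Eventually.of_forall h.tendsto)

end BoundedlyTendsto

/-- Properties of bounded measurable functions that are stable under linear combinations and bounded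
pointwise limits, the hypothesis of the functional monotone class theorem. -/
structure IsBoundedlyClosed (P : (X → ℂ) → Prop) : Prop where
  add : ∀ {f g}, IsBddMeasurable f → IsBddMeasurable g → P f → P g → P fun x => f x + g x
  const_mul : ∀ (a : ℂ) {f}, IsBddMeasurable f → P f → P fun x => a * f x
  limit : ∀ {F : ℕ → X → ℂ} {f}, BoundedlyTendsto F atTop f → (∀ n, P (F n)) → P f

/-- Sets of bounded measurable functions from which all bounded measurable functions are obtained by
linear combinations and bounded pointwise limits. -/
structure IsGenerating (G : Set (X → ℂ)) : Prop where
  isBddMeasurable : ∀ f ∈ G, IsBddMeasurable f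
  induction : ∀ {P}, IsBoundedlyClosed P → (∀ f ∈ G, P f) → ∀ f, IsBddMeasurable f → P f

theorem IsBoundedlyClosed.sum {ι : Type*} {F : ι → X → ℂ} (hP : IsBoundedlyClosed P)
    (zero : P fun _ => 0) (hF : ∀ i, IsBddMeasurable (F i)) (h : ∀ i, P (F i)) (s : Finset ι) :
    P fun x => ∑ i ∈ s, F i x := by
  classical
  induction s using Finset.induction_on with
  | empty => simpa using zero
  | insert i s hi ih =>
    simpa only [Finset.sum_insert hi] using hP.add (hF i) (.sum hF s) (h i) ih

theorem isGenerating_indicator :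
    IsGenerating {f : X → ℂ | ∃ S, MeasurableSet S ∧ f = S.indicator fun _ => 1} where
  isBddMeasurable := by
    rintro _ ⟨S, hS, rfl⟩
    exact (IsBddMeasurable.const 1).indicator hS
  induction {P} hP hind f hf := by
    have bdd (s : SimpleFunc X ℂ) : IsBddMeasurable (s : X → ℂ) :=
      ⟨s.measurable, s.exists_forall_norm_le⟩
    have simple (s : SimpleFunc X ℂ) : P s := by
      induction s using SimpleFunc.induction with
      | @const a S hS =>
        convert hP.const_mul a ((IsBddMeasurable.const 1).indicator hS) (hind _ ⟨S, hS, rfl⟩)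
          using 1
        ext x
        by_cases hx : x ∈ S <;> simp [SimpleFunc.coe_piecewise, hx]
      | add _ h h' => exact hP.add (bdd _) (bdd _) h h'
    obtain ⟨c, hc⟩ := hf.bounded
    have hm := hf.measurable.stronglyMeasurable
    exact hP.limit (F := fun n => hm.approxBounded |c| n) ⟨fun n => SimpleFunc.measurable _,
      ⟨|c|, fun n x => hm.norm_approxBounded_le (abs_nonneg c) n x⟩, fun x =>
        hm.tendsto_approxBounded_of_norm_le ((hc x).trans (le_abs_self c))⟩ fun n => simple _

theorem boundedlyTendsto_indicator_of_eventually_mem {ι : Type*} {l : Filter ι} {S : ι → Set X}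
    (hS : ∀ i, MeasurableSet (S i)) (hmem : ∀ x, ∀ᶠ i in l, x ∈ S i) :
    BoundedlyTendsto (fun i => (S i).indicator fun _ => (1 : ℂ)) l fun _ => 1 where
  measurable i := measurable_const.indicator (hS i)
  bounded := ⟨1, fun _ x => (norm_indicator_le_norm_self (fun _ => (1 : ℂ)) x).trans norm_one.le⟩
  tendsto x := tendsto_const_nhds.congr' <| (hmem x).mono fun _ hi =>
    (Set.indicator_of_mem hi fun _ => (1 : ℂ)).symm

theorem boundedlyTendsto_indicator_iUnion {S : ℕ → Set X} (hS : ∀ n, MeasurableSet (S n))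
    (hd : Pairwise (Function.onFun Disjoint S)) :
    BoundedlyTendsto (fun s x => ∑ i ∈ s, (S i).indicator (fun _ => (1 : ℂ)) x) atTop
      ((⋃ n, S n).indicator fun _ => 1) := by
  have sum_eq (s : Finset ℕ) (x : X) : ∑ i ∈ s, (S i).indicator (fun _ => (1 : ℂ)) x =
      (⋃ i ∈ s, S i).indicator (fun _ => 1) x :=
    (Finset.indicator_biUnion_apply _ S (fun i _ j _ h => hd h) x).symm
  refine ⟨fun s => Finset.measurable_sum _ fun i _ => measurable_const.indicator (hS i),
    ⟨1, fun s x => ?_⟩, fun x => ?_⟩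
  · rw [sum_eq]
    exact (norm_indicator_le_norm_self _ _).trans norm_one.le
  · simp only [sum_eq]
    exact (tendsto_indicator_biUnion_finset S _ x).mono_right (pure_le_nhds _)

theorem boundedlyTendsto_apprSeq {Y : Type*} [TopologicalSpace Y] [MeasurableSpace Y]
    [OpensMeasurableSpace Y] [HasOuterApproxClosed Y] {S : Set Y} (hS : IsClosed S) :
    BoundedlyTendsto (fun n y => ((hS.apprSeq n y : ℝ) : ℂ)) atTop (S.indicator fun _ => 1) := by
  refine ⟨fun n => (by fun_prop : Continuous fun y => ((hS.apprSeq n y : ℝ) : ℂ)).measurable,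
    ⟨1, fun n y => ?_⟩, fun y => ?_⟩
  · simpa using HasOuterApproxClosed.apprSeq_apply_le_one hS n y
  · have h := ((Complex.continuous_ofReal.comp NNReal.continuous_coe).tendsto _).comp
      (tendsto_pi_nhds.1 (HasOuterApproxClosed.tendsto_apprSeq hS) y)
    have indicator_eq : S.indicator (fun _ => (1 : ℂ)) y =
        (Complex.ofReal ∘ NNReal.toReal) (S.indicator (fun _ => 1) y) := by
      by_cases hy : y ∈ S <;> simp [hy]
    rw [indicator_eq]
    exact h

theorem isGenerating_range_coe_continuousMap {Y : Type*} [TopologicalSpace Y] [CompactSpace Y]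
    [HasOuterApproxClosed Y] [MeasurableSpace Y] [BorelSpace Y] :
    IsGenerating (Set.range ((⇑) : C(Y, ℂ) → Y → ℂ)) where
  isBddMeasurable := by
    rintro _ ⟨f, rfl⟩
    exact .of_continuousMap f
  induction {P} hP hcont f hf := by
    refine isGenerating_indicator.induction hP ?_ f hf
    rintro _ ⟨S, hS, rfl⟩
    have one : P fun _ => 1 := hcont _ ⟨1, rfl⟩
    induction S, hS using MeasurableSpace.induction_on_inter
      ((BorelSpace.measurable_eq (α := Y)).trans borel_eq_generateFrom_isClosed)
      isPiSystem_isClosed with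
    | empty => simpa using hP.const_mul 0 (.const 1) one
    | basic S hS =>
      exact hP.limit (boundedlyTendsto_apprSeq hS) fun n =>
        hcont _ ⟨⟨fun y => ((hS.apprSeq n y : ℝ) : ℂ), by fun_prop⟩, rfl⟩
    | compl S hS ih =>
      have hbdd := (IsBddMeasurable.const 1).indicator hS
      convert hP.add (.const 1) ((IsBddMeasurable.const (-1)).mul hbdd) one
        (hP.const_mul (-1) hbdd ih) using 1
      ext y
      by_cases hy : y ∈ S <;> simp [hy]
    | iUnion S hd hS ih =>
      exact hP.limit ((boundedlyTendsto_indicator_iUnion hS hd).comp tendsto_finset_range) fun n =>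
        hP.sum (by simpa using hP.const_mul 0 (.const 1) one)
          (fun n => (IsBddMeasurable.const 1).indicator (hS n)) ih (Finset.range n)

end BoundedMeasurable

/-! ### Operators given by integrals of scalar measures -/

/-- The total mass of `μ φ` is `‖φ‖²`, as it is for the scalar measures of a projection-valued
measure. -/
def HasMassNormSq {H X : Type*} [NormedAddCommGroup H] [MeasurableSpace X] (μ : H → Measure X) :
    Prop :=
  ∀ φ, μ φ Set.univ = ENNReal.ofReal (‖φ‖ ^ 2)

theorem HasMassNormSq.isFiniteMeasure {H X : Type*} [NormedAddCommGroup H] [MeasurableSpace X]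
    {μ : H → Measure X} (hμ : HasMassNormSq μ) (φ : H) : IsFiniteMeasure (μ φ) :=
  ⟨by rw [hμ]; exact ENNReal.ofReal_lt_top⟩

section HasForm

variable {H : Type*} [NormedAddCommGroup H] [InnerProductSpace ℂ H]
  {X : Type*} [MeasurableSpace X] {μ : H → Measure X} {f g : X → ℂ} {S T : H →L[ℂ] H}

/-- `T` is the operator with quadratic form `φ ↦ ∫ f dμ_φ`. -/
def HasForm (μ : H → Measure X) (f : X → ℂ) (T : H →L[ℂ] H) : Prop :=
  ∀ φ : H, ⟪φ, T φ⟫_ℂ = ∫ x, f x ∂(μ φ)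

namespace HasForm

theorem unique (hS : HasForm μ f S) (hT : HasForm μ f T) : S = T := by
  refine ContinuousLinearMap.coe_injective ((ext_inner_map _ _).1 fun x => ?_)
  rw [← inner_conj_symm, ← inner_conj_symm (_ : H) x]
  exact congrArg _ ((hS x).trans (hT x).symm)

theorem norm_le (hμ : HasMassNormSq μ) (h : HasForm μ f T) {c : ℝ} (hc : 0 ≤ c)
    (hf : ∀ x, ‖f x‖ ≤ c) : ‖T‖ ≤ 2 * c := by
  refine opNorm_le_two_mul_of_norm_inner_self_le (fun φ => ?_) hc
  have := hμ.isFiniteMeasure φ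
  rw [h φ]
  refine (norm_integral_le_of_norm_le_const (Eventually.of_forall hf)).trans_eq ?_
  rw [measureReal_def, hμ, ENNReal.toReal_ofReal (by positivity)]

theorem one (hμ : HasMassNormSq μ) : HasForm μ (fun _ => 1) 1 := fun φ => by
  rw [integral_const, measureReal_def, hμ, ENNReal.toReal_ofReal (by positivity)]
  simp [inner_self_eq_norm_sq_to_K]

theorem add (hμ : HasMassNormSq μ) (hf : IsBddMeasurable f) (hg : IsBddMeasurable g)
    (hS : HasForm μ f S) (hT : HasForm μ g T) : HasForm μ (fun x => f x + g x) (S + T) :=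
  fun φ => by
    have := hμ.isFiniteMeasure φ
    rw [integral_add (hf.integrable _) (hg.integrable _), ← hS, ← hT, add_apply, inner_add_right]

theorem const_mul (a : ℂ) (hT : HasForm μ f T) : HasForm μ (fun x => a * f x) (a • T) := fun φ => by
  rw [integral_const_mul, ← hT, smul_apply, inner_smul_right]

theorem conj [CompleteSpace H] (hT : HasForm μ f T) :
    HasForm μ (fun x => starRingEnd ℂ (f x)) (star T) := fun φ => by
  rw [integral_conj, ← hT, inner_conj_symm, ContinuousLinearMap.star_eq_adjoint,
    ContinuousLinearMap.adjoint_inner_right]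

end HasForm

theorem isBoundedlyClosed_exists_hasForm [CompleteSpace H] (hμ : HasMassNormSq μ) :
    IsBoundedlyClosed fun f : X → ℂ => ∃ T, HasForm μ f T where
  add := fun hf hg ⟨S, hS⟩ ⟨T, hT⟩ => ⟨S + T, hS.add hμ hf hg hT⟩
  const_mul := fun a _ _ ⟨T, hT⟩ => ⟨a • T, hT.const_mul a⟩
  limit := fun {F f} hF hT => by
    choose T hT using hT
    have tendsto_form φ : Tendsto (fun n => ⟪φ, T n φ⟫_ℂ) atTop (𝓝 (∫ x, f x ∂(μ φ))) := by
      have := hμ.isFiniteMeasure φ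
      simpa only [hT _ φ] using hF.tendsto_integral (μ φ)
    obtain ⟨c, hc⟩ := hF.bounded
    obtain ⟨T₀, hT₀⟩ := exists_forall_tendsto_inner_apply
      (fun n => (hT n).norm_le hμ (abs_nonneg c) fun x => (hc n x).trans (le_abs_self c))
      tendsto_form
    exact ⟨T₀, fun φ => tendsto_nhds_unique (hT₀ φ φ) (tendsto_form φ)⟩

/-- `Φ f` is the operator with form `φ ↦ ∫ f dμ_φ`, for every bounded measurable `f`. -/
structure IsFormCalculus (μ : H → Measure X) (Φ : (X → ℂ) → H →L[ℂ] H) : Prop where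
  hasMassNormSq : HasMassNormSq μ
  hasForm : ∀ {f}, IsBddMeasurable f → HasForm μ f (Φ f)

/-- A multiplicative calculus of bounded measurable functions represented by scalar measures. -/
structure IsBorelCalculus (μ : H → Measure X) (Φ : (X → ℂ) → H →L[ℂ] H) : Prop extends
    IsFormCalculus μ Φ where
  map_mul : ∀ {f g}, IsBddMeasurable f → IsBddMeasurable g → Φ (fun x => f x * g x) = Φ f * Φ g

theorem exists_isFormCalculus_of_isGenerating [CompleteSpace H] {G : Set (X → ℂ)}
    (hG : IsGenerating G) (hμ : HasMassNormSq μ) (h : ∀ f ∈ G, ∃ T, HasForm μ f T) :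
    ∃ Φ, IsFormCalculus μ Φ := by
  have exists_form := hG.induction (isBoundedlyClosed_exists_hasForm hμ) h
  choose! Φ hΦ using exists_form
  exact ⟨Φ, hμ, hΦ _⟩

namespace IsFormCalculus

variable {Φ : (X → ℂ) → H →L[ℂ] H} (hΦ : IsFormCalculus μ Φ)

include hΦ

theorem map_eq (hf : IsBddMeasurable f) (hT : HasForm μ f T) : Φ f = T := (hΦ.hasForm hf).unique hT

theorem map_one : Φ (fun _ => 1) = 1 := hΦ.map_eq (.const 1) (.one hΦ.hasMassNormSq)

theorem map_add (hf : IsBddMeasurable f) (hg : IsBddMeasurable g) :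
    Φ (fun x => f x + g x) = Φ f + Φ g :=
  hΦ.map_eq (hf.add hg) ((hΦ.hasForm hf).add hΦ.hasMassNormSq hf hg (hΦ.hasForm hg))

theorem map_const_mul (a : ℂ) (hf : IsBddMeasurable f) : Φ (fun x => a * f x) = a • Φ f :=
  hΦ.map_eq ((IsBddMeasurable.const a).mul hf) ((hΦ.hasForm hf).const_mul a)

theorem map_sub (hf : IsBddMeasurable f) (hg : IsBddMeasurable g) :
    Φ (fun x => f x - g x) = Φ f - Φ g := by
  have h := hΦ.map_add hf ((IsBddMeasurable.const (-1)).mul hg)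
  rw [hΦ.map_const_mul (-1) hg] at h
  simpa only [neg_one_mul, neg_one_smul, ← sub_eq_add_neg] using h

theorem map_zero : Φ (fun _ => 0) = 0 := hΦ.map_eq (.const 0) fun φ => by simp

theorem map_sum {ι : Type*} {F : ι → X → ℂ} (hF : ∀ i, IsBddMeasurable (F i)) (s : Finset ι) :
    Φ (fun x => ∑ i ∈ s, F i x) = ∑ i ∈ s, Φ (F i) := by
  classical
  induction s using Finset.induction_on with
  | empty => simpa using hΦ.map_zero
  | insert i s hi ih =>
    simp only [Finset.sum_insert hi]
    rw [hΦ.map_add (hF i) (.sum hF s), ih]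

theorem map_conj [CompleteSpace H] (hf : IsBddMeasurable f) :
    Φ (fun x => starRingEnd ℂ (f x)) = star (Φ f) :=
  hΦ.map_eq hf.conj (hΦ.hasForm hf).conj

theorem tendsto_inner {F : ℕ → X → ℂ} (hF : BoundedlyTendsto F atTop f) (ψ φ : H) :
    Tendsto (fun n => ⟪ψ, Φ (F n) φ⟫_ℂ) atTop (𝓝 ⟪ψ, Φ f φ⟫_ℂ) := by
  refine tendsto_inner_map_inner_map_of_forall_self (S := LinearMap.id)
    (T := fun n => (Φ (F n) : H →ₗ[ℂ] H)) (T₀ := (Φ f : H →ₗ[ℂ] H)) (fun x => ?_) ψ φ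
  have := hΦ.hasMassNormSq.isFiniteMeasure x
  simpa [hΦ.hasForm (hF.isBddMeasurable _) x, hΦ.hasForm hF.isBddMeasurable_limit x] using
    hF.tendsto_integral (μ x)

theorem isBoundedlyClosed_map_mul (hg : IsBddMeasurable g) (Q : H →L[ℂ] H) :
    IsBoundedlyClosed fun f => Φ (fun x => f x * g x) = Φ f * Q where
  add := fun {f f'} hf hf' h h' => by
    simp only [add_mul]
    rw [hΦ.map_add (hf.mul hg) (hf'.mul hg), hΦ.map_add hf hf', h, h', add_mul]
  const_mul := fun a f hf h => by
    simp only [mul_assoc]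
    rw [hΦ.map_const_mul a (hf.mul hg), hΦ.map_const_mul a hf, h, smul_mul_assoc]
  limit := fun {F f} hF h => by
    refine ContinuousLinearMap.ext fun φ => ext_inner_left ℂ fun ψ =>
      tendsto_nhds_unique (hΦ.tendsto_inner (hF.mul_right hg) ψ φ) ?_
    simpa only [h, mul_apply_eq_comp] using hΦ.tendsto_inner hF ψ (Q φ)

theorem isBorelCalculus_of_isGenerating [CompleteSpace H] {G : Set (X → ℂ)} (hG : IsGenerating G)
    (hconj : ∀ f ∈ G, (fun x => starRingEnd ℂ (f x)) ∈ G)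
    (hmul : ∀ f ∈ G, ∀ g ∈ G, Φ (fun x => f x * g x) = Φ f * Φ g) : IsBorelCalculus μ Φ := by
  refine ⟨hΦ, fun {f g} hf hg => ?_⟩
  have mul_left {f g : X → ℂ} (hf : IsBddMeasurable f) (hg : g ∈ G) :
      Φ (fun x => f x * g x) = Φ f * Φ g :=
    hG.induction (hΦ.isBoundedlyClosed_map_mul (hG.isBddMeasurable g hg) _)
      (fun f hf => hmul f hf g hg) f hf
  refine hG.induction (hΦ.isBoundedlyClosed_map_mul hg _) (fun f hf => ?_) f hf
  have h := congrArg star (mul_left hg.conj (hconj f hf))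
  rw [← hΦ.map_conj (hg.conj.mul (hG.isBddMeasurable f hf).conj), star_mul, ← hΦ.map_conj hg.conj,
    ← hΦ.map_conj (hG.isBddMeasurable f hf).conj] at h
  simpa only [_root_.map_mul, Complex.conj_conj, mul_comm (g _)] using h

end IsFormCalculus

namespace IsBorelCalculus

variable [CompleteSpace H] {Φ : (X → ℂ) → H →L[ℂ] H} (hΦ : IsBorelCalculus μ Φ)

include hΦ

theorem norm_sq_map_apply (hf : IsBddMeasurable f) (φ : H) :
    ‖Φ f φ‖ ^ 2 = ∫ x, ‖f x‖ ^ 2 ∂(μ φ) := by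
  have h := hΦ.hasForm (hf.conj.mul hf) φ
  rw [hΦ.map_mul hf.conj hf, hΦ.map_conj hf, ContinuousLinearMap.star_eq_adjoint,
    mul_apply_eq_comp, ContinuousLinearMap.adjoint_inner_right, inner_self_eq_norm_sq_to_K] at h
  simp_rw [Complex.conj_mul', ← Complex.ofReal_pow] at h
  rw [integral_complex_ofReal] at h
  exact Complex.ofReal_injective (by simpa using h)

theorem enorm_sq_map_apply (hf : IsBddMeasurable f) (φ : H) :
    ‖Φ f φ‖ₑ ^ 2 = ∫⁻ x, ‖f x‖ₑ ^ 2 ∂(μ φ) := by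
  have := hΦ.hasMassNormSq.isFiniteMeasure φ
  have integrable : Integrable (fun x => ‖f x‖ ^ 2) (μ φ) := by
    simpa using ((hf.conj.mul hf).integrable (μ φ)).norm.congr
      (Eventually.of_forall fun x => by simp [sq])
  rw [← ofReal_norm, ← ENNReal.ofReal_pow (norm_nonneg _), hΦ.norm_sq_map_apply hf φ,
    ofReal_integral_eq_lintegral_ofReal integrable (Eventually.of_forall fun x => by positivity)]
  refine lintegral_congr fun x => ?_
  rw [← ofReal_norm, ← ENNReal.ofReal_pow (norm_nonneg _)]

theorem enorm_sq_map_indicator_apply {S : Set X} (hS : MeasurableSet S) (φ : H) :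
    ‖Φ (S.indicator fun _ => 1) φ‖ₑ ^ 2 = μ φ S := by
  rw [hΦ.enorm_sq_map_apply ((IsBddMeasurable.const 1).indicator hS), ← lintegral_indicator_one hS]
  refine lintegral_congr fun x => ?_
  by_cases hx : x ∈ S <;> simp [hx]

theorem tendsto_map_apply {ι : Type*} {l : Filter ι} [l.NeBot] [l.IsCountablyGenerated]
    {F : ι → X → ℂ} (hF : BoundedlyTendsto F l f) (φ : H) :
    Tendsto (fun i => Φ (F i) φ) l (𝓝 (Φ f φ)) := by
  have := hΦ.hasMassNormSq.isFiniteMeasure φ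
  have hf := hF.isBddMeasurable_limit
  have norm_sq (i : ι) : ‖Φ (F i) φ - Φ f φ‖ ^ 2 = ∫ x, ‖F i x - f x‖ ^ 2 ∂(μ φ) := by
    have hi := hF.isBddMeasurable i
    rw [← sub_apply, ← hΦ.map_sub hi hf]
    exact hΦ.norm_sq_map_apply (hi.sub hf) φ
  obtain ⟨c, hc⟩ := hF.bounded
  obtain ⟨d, hd⟩ := hf.bounded
  have tendsto_zero : Tendsto (fun i => ‖Φ (F i) φ - Φ f φ‖ ^ 2) l (𝓝 0) := by
    simp only [norm_sq]
    simpa using tendsto_integral_filter_of_dominated_convergence (f := fun _ => (0 : ℝ))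
      (fun _ => (c + d) ^ 2)
      (Eventually.of_forall fun i =>
        (((hF.measurable i).sub hf.measurable).norm.pow_const 2).aestronglyMeasurable)
      (Eventually.of_forall fun i => Eventually.of_forall fun x => by
        rw [norm_pow, norm_norm]
        gcongr
        exact (norm_sub_le _ _).trans (add_le_add (hc i x) (hd x)))
      (integrable_const _) (Eventually.of_forall fun x => by
        simpa using ((tendsto_iff_norm_sub_tendsto_zero.1 (hF.tendsto x)).pow 2))
  rw [tendsto_iff_norm_sub_tendsto_zero]
  simpa [Real.sqrt_sq (norm_nonneg _)] using tendsto_zero.sqrt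

theorem ae_ne_zero_of_injective (hf : IsBddMeasurable f) (hinj : Function.Injective (Φ f)) (φ : H) :
    ∀ᵐ x ∂(μ φ), f x ≠ 0 := by
  have hS : MeasurableSet {x | f x = 0} := measurableSet_eq_fun hf.measurable measurable_const
  have mul_indicator : (fun x => f x * {x | f x = 0}.indicator (fun _ => 1) x) = fun _ => 0 := by
    ext x
    by_cases hx : f x = 0 <;> simp [hx]
  have comp_eq_zero := hΦ.map_mul hf ((IsBddMeasurable.const 1).indicator hS)
  rw [mul_indicator, hΦ.map_zero] at comp_eq_zero
  have apply_eq_zero : Φ ({x | f x = 0}.indicator fun _ => 1) φ = 0 :=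
    hinj (by rw [_root_.map_zero, ← mul_apply_eq_comp, ← comp_eq_zero, zero_apply])
  have h := hΦ.enorm_sq_map_indicator_apply hS φ
  rw [apply_eq_zero, enorm_zero, zero_pow two_ne_zero] at h
  simpa [ae_iff] using h.symm

end IsBorelCalculus

end HasForm

/-! ### Projection-valued measures and Borel functional calculi -/

section Calculus

variable {H : Type*} [NormedAddCommGroup H] [InnerProductSpace ℂ H] [CompleteSpace H]

namespace ProjectionValuedMeasure

variable (E : ProjectionValuedMeasure H) {f g : ℝ → ℂ}

theorem hasMassNormSq_scalarMeasure : HasMassNormSq E.scalarMeasure := fun φ => by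
  rw [E.scalarMeasure_apply φ MeasurableSet.univ, E.re_inner_proj MeasurableSet.univ, E.proj_univ,
    one_apply_eq_self]

instance (φ : H) : IsFiniteMeasure (E.scalarMeasure φ) :=
  E.hasMassNormSq_scalarMeasure.isFiniteMeasure φ

theorem hasForm_indicator {S : Set ℝ} (hS : MeasurableSet S) :
    HasForm E.scalarMeasure (S.indicator fun _ => 1) (E.proj S) := fun φ => by
  have self_adjoint : starRingEnd ℂ ⟪φ, E.proj S φ⟫_ℂ = ⟪φ, E.proj S φ⟫_ℂ := by
    rw [inner_conj_symm, ← ContinuousLinearMap.adjoint_inner_right,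
      ← ContinuousLinearMap.star_eq_adjoint, (E.isStarProjection S hS).isSelfAdjoint.star_eq]
  rw [integral_indicator_const _ hS, measureReal_def, E.scalarMeasure_apply φ hS,
    ENNReal.toReal_ofReal (by rw [E.re_inner_proj hS]; positivity), Complex.real_smul, mul_one]
  exact (Complex.conj_eq_iff_re.1 self_adjoint).symm

theorem isFormCalculus_integral : IsFormCalculus E.scalarMeasure E.integral where
  hasMassNormSq := E.hasMassNormSq_scalarMeasure
  hasForm {f} hf := by
    obtain ⟨Φ, hΦ⟩ := exists_isFormCalculus_of_isGenerating isGenerating_indicator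
      E.hasMassNormSq_scalarMeasure (by
        rintro _ ⟨S, hS, rfl⟩
        exact ⟨_, E.hasForm_indicator hS⟩)
    have h : ∃ T : H →L[ℂ] H, ∀ φ : H, ⟪φ, T φ⟫_ℂ = ∫ x, f x ∂(E.scalarMeasure φ) :=
      ⟨Φ f, hΦ.hasForm hf⟩
    rw [integral, dif_pos h]
    exact h.choose_spec

theorem integral_indicator_one {S : Set ℝ} (hS : MeasurableSet S) :
    E.integral (S.indicator fun _ => 1) = E.proj S :=
  E.isFormCalculus_integral.map_eq ((IsBddMeasurable.const 1).indicator hS) (E.hasForm_indicator hS)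

theorem isBorelCalculus_integral : IsBorelCalculus E.scalarMeasure E.integral := by
  refine E.isFormCalculus_integral.isBorelCalculus_of_isGenerating isGenerating_indicator ?_ ?_
  · rintro _ ⟨S, hS, rfl⟩
    refine ⟨S, hS, funext fun x => ?_⟩
    by_cases hx : x ∈ S <;> simp [hx]
  · rintro _ ⟨S, hS, rfl⟩ _ ⟨S', hS', rfl⟩
    rw [E.integral_indicator_one hS, E.integral_indicator_one hS', ← E.proj_inter S S' hS hS',
      ← E.integral_indicator_one (hS.inter hS')]
    congr 1
    ext x
    by_cases hx : x ∈ S <;> by_cases hx' : x ∈ S' <;> simp [hx, hx']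

theorem enorm_sq_proj (φ : H) {S : Set ℝ} (hS : MeasurableSet S) :
    ‖E.proj S φ‖ₑ ^ 2 = E.scalarMeasure φ S := by
  rw [← E.integral_indicator_one hS, E.isBorelCalculus_integral.enorm_sq_map_indicator_apply hS]

theorem tendsto_proj_apply {ι : Type*} {l : Filter ι} [l.NeBot] [l.IsCountablyGenerated]
    {S : ι → Set ℝ} (hS : ∀ i, MeasurableSet (S i)) (hmem : ∀ x, ∀ᶠ i in l, x ∈ S i) (φ : H) :
    Tendsto (fun i => E.proj (S i) φ) l (𝓝 φ) := by
  have h := E.isBorelCalculus_integral.tendsto_map_apply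
    (boundedlyTendsto_indicator_of_eventually_mem hS hmem) φ
  simpa only [E.integral_indicator_one (hS _), E.isFormCalculus_integral.map_one,
    one_apply_eq_self] using h

theorem scalarMeasure_integral_apply (hf : IsBddMeasurable f) (φ : H) :
    E.scalarMeasure (E.integral f φ) = (E.scalarMeasure φ).withDensity fun x => ‖f x‖ₑ ^ 2 := by
  ext S hS
  have hind : IsBddMeasurable (S.indicator fun _ => (1 : ℂ)) :=
    (IsBddMeasurable.const _).indicator hS
  rw [← E.enorm_sq_proj _ hS, withDensity_apply _ hS, ← E.integral_indicator_one hS,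
    ← mul_apply_eq_comp, ← E.isBorelCalculus_integral.map_mul hind hf,
    E.isBorelCalculus_integral.enorm_sq_map_apply (hind.mul hf), ← lintegral_indicator hS]
  refine lintegral_congr fun x => ?_
  by_cases hx : x ∈ S <;> simp [hx]

end ProjectionValuedMeasure

namespace IsBorelCalculus

variable {X : Type*} [MeasurableSpace X] {μ : H → Measure X} {Φ : (X → ℂ) → H →L[ℂ] H}

theorem isStarProjection_map_indicator (hΦ : IsBorelCalculus μ Φ) {S : Set X}
    (hS : MeasurableSet S) : IsStarProjection (Φ (S.indicator fun _ => 1)) := by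
  have hind : IsBddMeasurable (S.indicator fun _ => (1 : ℂ)) :=
    (IsBddMeasurable.const _).indicator hS
  constructor
  · rw [IsIdempotentElem, ← hΦ.map_mul hind hind]
    congr 1
    ext x
    by_cases hx : x ∈ S <;> simp [hx]
  · rw [IsSelfAdjoint, ← hΦ.map_conj hind]
    congr 1
    ext x
    by_cases hx : x ∈ S <;> simp [hx]

/-- The projection-valued measure of a real function in a Borel functional calculus. -/
def projectionValuedMeasure (hΦ : IsBorelCalculus μ Φ) {h : X → ℝ} (hh : Measurable h) :
    ProjectionValuedMeasure H where
  proj S := Φ ((h ⁻¹' S).indicator fun _ => 1)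
  isStarProjection S hS := hΦ.isStarProjection_map_indicator (hh hS)
  proj_univ := by simpa using hΦ.map_one
  proj_inter S S' hS hS' := by
    rw [← hΦ.map_mul ((IsBddMeasurable.const 1).indicator (hh hS))
      ((IsBddMeasurable.const 1).indicator (hh hS'))]
    congr 1
    ext x
    by_cases hx : h x ∈ S <;> by_cases hx' : h x ∈ S' <;> simp [hx, hx']
  hasSum_proj S hS hd φ := by
    rw [Set.preimage_iUnion, HasSum, SummationFilter.unconditional_filter]
    have h := hΦ.tendsto_map_apply (boundedlyTendsto_indicator_iUnion (fun n => hh (hS n))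
      fun i j hij => (hd hij).preimage h) φ
    simpa only [hΦ.map_sum (fun n => (IsBddMeasurable.const 1).indicator (hh (hS n))),
      sum_apply] using h

theorem scalarMeasure_projectionValuedMeasure (hΦ : IsBorelCalculus μ Φ) {h : X → ℝ}
    (hh : Measurable h) (φ : H) :
    (hΦ.projectionValuedMeasure hh).scalarMeasure φ = (μ φ).map h := by
  ext S hS
  rw [← ProjectionValuedMeasure.enorm_sq_proj _ φ hS, Measure.map_apply hh hS]
  exact hΦ.enorm_sq_map_indicator_apply (hh hS) φ

end IsBorelCalculus

end Calculus

/-! ### Normal operators -/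

section Normal

variable {H : Type*} [NormedAddCommGroup H] [InnerProductSpace ℂ H] [CompleteSpace H]
  {R : H →L[ℂ] H}

/-- The real functional `g ↦ ⟨φ, g(R) φ⟩` on continuous functions on the spectrum of `R`. -/
def cfcFunctional (hR : IsStarNormal R) (φ : H) :
    CompactlySupportedContinuousMap (spectrum ℂ R) ℝ →ₚ[ℝ] ℝ :=
  PositiveLinearMap.mk₀
    { toFun := fun g => (⟪φ, cfcHom hR ⟨fun y => (g y : ℂ), by fun_prop⟩ φ⟫_ℂ).re
      map_add' := fun g g' => by
        rw [← Complex.add_re, ← inner_add_right, ← add_apply, ← map_add]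
        congr 5
        ext y
        simp
      map_smul' := fun a g => by
        have smul_eq : (⟨fun y => ((a • g) y : ℂ), by fun_prop⟩ : C(spectrum ℂ R, ℂ)) =
            (a : ℂ) • ⟨fun y => (g y : ℂ), by fun_prop⟩ := by
          ext y
          simp
        rw [smul_eq, map_smul, smul_apply, inner_smul_right]
        simp }
    fun g hg => by
      have eq_star_mul_self : (⟨fun y => (g y : ℂ), by fun_prop⟩ : C(spectrum ℂ R, ℂ)) =
          star (⟨fun y => (√(g y) : ℂ), by fun_prop⟩ : C(spectrum ℂ R, ℂ)) *
            ⟨fun y => (√(g y) : ℂ), by fun_prop⟩ := by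
        ext y
        simp only [ContinuousMap.coe_mk, ContinuousMap.mul_apply, ContinuousMap.star_apply,
          Complex.star_def, Complex.conj_ofReal, ← Complex.ofReal_mul, Real.mul_self_sqrt (hg y)]
      simp only [LinearMap.coe_mk, AddHom.coe_mk]
      rw [eq_star_mul_self, map_mul, map_star, mul_apply_eq_comp,
        ContinuousLinearMap.star_eq_adjoint, ContinuousLinearMap.adjoint_inner_right]
      exact inner_self_nonneg (𝕜 := ℂ)

theorem cfcFunctional_apply (hR : IsStarNormal R) (φ : H)
    (g : CompactlySupportedContinuousMap (spectrum ℂ R) ℝ) :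
    cfcFunctional hR φ g = (⟪φ, cfcHom hR ⟨fun y => (g y : ℂ), by fun_prop⟩ φ⟫_ℂ).re := rfl

/-- The scalar spectral measure of a normal operator `R` at `φ`. -/
def cfcMeasure (hR : IsStarNormal R) (φ : H) : Measure (spectrum ℂ R) :=
  RealRMK.rieszMeasure (cfcFunctional hR φ)

instance (hR : IsStarNormal R) (φ : H) : IsFiniteMeasure (cfcMeasure hR φ) :=
  ⟨by unfold cfcMeasure; exact (isCompact_univ (X := spectrum ℂ R)).measure_lt_top⟩

theorem inner_cfcHom_ofReal (hR : IsStarNormal R) (φ : H) (g : C(spectrum ℂ R, ℝ)) :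
    ⟪φ, cfcHom hR ⟨fun y => (g y : ℂ), by fun_prop⟩ φ⟫_ℂ =
      ((∫ y, g y ∂(cfcMeasure hR φ) : ℝ) : ℂ) := by
  have h := RealRMK.integral_rieszMeasure (cfcFunctional hR φ)
    (CompactlySupportedContinuousMap.continuousMapEquiv g)
  rw [cfcFunctional_apply] at h
  simp only [CompactlySupportedContinuousMap.continuousMapEquiv_apply_toFun] at h
  rw [cfcMeasure, h, eq_comm, ← Complex.conj_eq_iff_re, inner_conj_symm,
    ← ContinuousLinearMap.adjoint_inner_right, ← ContinuousLinearMap.star_eq_adjoint, ← map_star]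
  congr 4
  ext y
  simp

theorem hasForm_cfcHom (hR : IsStarNormal R) (f : C(spectrum ℂ R, ℂ)) :
    HasForm (cfcMeasure hR) f (cfcHom hR f) := fun φ => by
  have eq_re_add_im : f = (⟨fun y => ((f y).re : ℂ), by fun_prop⟩ : C(spectrum ℂ R, ℂ)) +
      Complex.I • ⟨fun y => ((f y).im : ℂ), by fun_prop⟩ := by
    ext y
    simp [mul_comm Complex.I]
  have form_re := inner_cfcHom_ofReal hR φ ⟨fun y => (f y).re, by fun_prop⟩
  have form_im := inner_cfcHom_ofReal hR φ ⟨fun y => (f y).im, by fun_prop⟩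
  simp only [ContinuousMap.coe_mk] at form_re form_im
  conv_lhs => rw [eq_re_add_im, map_add, map_smul, add_apply, smul_apply, inner_add_right,
    inner_smul_right, form_re, form_im, mul_comm]
  exact integral_re_add_im ((IsBddMeasurable.of_continuousMap f).integrable _)

theorem hasMassNormSq_cfcMeasure (hR : IsStarNormal R) : HasMassNormSq (cfcMeasure hR) :=
    fun φ => by
  have h := hasForm_cfcHom hR 1 φ
  rw [map_one, one_apply_eq_self, inner_self_eq_norm_sq_to_K] at h
  simp only [ContinuousMap.one_apply, integral_const, mul_one, Complex.real_smul,
    Complex.coe_algebraMap, ← Complex.ofReal_pow, Complex.ofReal_inj] at h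
  rw [h, measureReal_def, ENNReal.ofReal_toReal (measure_ne_top _ _)]

theorem exists_isBorelCalculus_cfcMeasure (hR : IsStarNormal R) :
    ∃ Φ, IsBorelCalculus (cfcMeasure hR) Φ := by
  obtain ⟨Φ, hΦ⟩ := exists_isFormCalculus_of_isGenerating isGenerating_range_coe_continuousMap
    (hasMassNormSq_cfcMeasure hR) (by
      rintro _ ⟨f, rfl⟩
      exact ⟨_, hasForm_cfcHom hR f⟩)
  have map_coe (f : C(spectrum ℂ R, ℂ)) : Φ f = cfcHom hR f :=
    hΦ.map_eq (.of_continuousMap f) (hasForm_cfcHom hR f)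
  refine ⟨Φ, hΦ.isBorelCalculus_of_isGenerating isGenerating_range_coe_continuousMap ?_ ?_⟩
  · rintro _ ⟨f, rfl⟩
    exact ⟨star f, rfl⟩
  · rintro _ ⟨f, rfl⟩ _ ⟨g, rfl⟩
    exact (map_coe (f * g)).trans (by rw [map_mul, map_coe, map_coe])

theorem hasForm_coe_cfcMeasure (hR : IsStarNormal R) :
    HasForm (cfcMeasure hR) (fun y => (y : ℂ)) R := by
  have h := hasForm_cfcHom hR ((ContinuousMap.id ℂ).restrict (spectrum ℂ R))
  rw [cfcHom_id hR] at h
  exact h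

theorem ae_ne_zero_cfcMeasure (hR : IsStarNormal R) (hinj : Function.Injective R) (φ : H) :
    ∀ᵐ y : spectrum ℂ R ∂(cfcMeasure hR φ), (y : ℂ) ≠ 0 := by
  obtain ⟨Φ, hΦ⟩ := exists_isBorelCalculus_cfcMeasure hR
  have bdd : IsBddMeasurable fun y : spectrum ℂ R => (y : ℂ) :=
    .of_continuousMap ((ContinuousMap.id ℂ).restrict (spectrum ℂ R))
  refine hΦ.ae_ne_zero_of_injective bdd ?_ φ
  rwa [hΦ.map_eq bdd (hasForm_coe_cfcMeasure hR)]

end Normal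

/-! ### Resolvents of self-adjoint operators -/

section Resolvent

variable {H : Type*} [NormedAddCommGroup H] [InnerProductSpace ℂ H] {B : H →ₗ.[ℂ] H} {z w : ℂ}
  {R S : H →L[ℂ] H}

namespace IsResolventAt

theorem mem_domain (hR : IsResolventAt B z R) (ψ : H) : R ψ ∈ B.domain := (hR.1 ψ).1

theorem apply_map (hR : IsResolventAt B z R) (ψ : H) :
    B ⟨R ψ, hR.mem_domain ψ⟩ = ψ + z • R ψ := by
  obtain ⟨_, h⟩ := hR.1 ψ
  exact sub_eq_iff_eq_add.1 h

theorem injective (hR : IsResolventAt B z R) : Function.Injective R := by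
  refine (injective_iff_map_eq_zero R).2 fun ψ hψ => ?_
  have zero_of_map : (⟨R ψ, hR.mem_domain ψ⟩ : B.domain) = 0 := Subtype.ext hψ
  have h := hR.apply_map ψ
  rw [zero_of_map, LinearPMap.map_zero, hψ, smul_zero, add_zero] at h
  exact h.symm

theorem sub_eq_smul_mul (hR : IsResolventAt B z R) (hS : IsResolventAt B w S) :
    R - S = (z - w) • (R * S) := by
  ext ψ
  have h := hR.2 ⟨S ψ, hS.mem_domain ψ⟩
  rw [hS.apply_map] at h
  simp only [map_sub, map_add, map_smul] at h
  simp only [sub_apply, smul_apply, mul_apply_eq_comp]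
  conv_lhs => rw [← h]
  module

theorem unique (hR : IsResolventAt B z R) (hS : IsResolventAt B z S) : R = S := by
  rw [← sub_eq_zero, hR.sub_eq_smul_mul hS, sub_self, zero_smul]

theorem commute (hR : IsResolventAt B z R) (hS : IsResolventAt B w S) : Commute R S := by
  by_cases hzw : z = w
  · subst hzw
    rw [hR.unique hS]
  · have smul_eq : (z - w) • (R * S) = (z - w) • (S * R) := by
      rw [← hR.sub_eq_smul_mul hS, ← neg_sub S R, hS.sub_eq_smul_mul hR, ← neg_smul, neg_sub]
    exact smul_right_injective _ (sub_ne_zero.2 hzw) smul_eq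

end IsResolventAt

section SelfAdjoint

variable [CompleteSpace H]

theorem inner_apply_left_of_isSelfAdjoint (hB : IsSelfAdjoint B) (φ ψ : B.domain) :
    ⟪B φ, (ψ : H)⟫_ℂ = ⟪(φ : H), B ψ⟫_ℂ := by
  have h := LinearPMap.adjoint_isFormalAdjoint hB.dense_domain
  rw [LinearPMap.isSelfAdjoint_def.1 hB] at h
  exact h φ ψ

theorem exists_apply_eq_of_isSelfAdjoint (hB : IsSelfAdjoint B) {y w : H}
    (h : ∀ x : B.domain, ⟪w, (x : H)⟫_ℂ = ⟪y, B x⟫_ℂ) : ∃ hy : y ∈ B.domain, B ⟨y, hy⟩ = w := by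
  have mem_adjoint := B.mem_adjoint_domain_of_exists y ⟨w, h⟩
  have adjoint_apply := LinearPMap.adjoint_apply_eq hB.dense_domain ⟨y, mem_adjoint⟩ h
  generalize hC : B.adjoint = C at mem_adjoint adjoint_apply
  obtain rfl : C = B := hC.symm.trans (LinearPMap.isSelfAdjoint_def.1 hB)
  exact ⟨mem_adjoint, adjoint_apply⟩

namespace IsResolventAt

protected theorem star (hB : IsSelfAdjoint B) (hR : IsResolventAt B z R) :
    IsResolventAt B (starRingEnd ℂ z) (star R) := by
  rw [ContinuousLinearMap.star_eq_adjoint]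
  constructor
  · intro y
    obtain ⟨mem, apply_eq⟩ := exists_apply_eq_of_isSelfAdjoint hB
      (y := ContinuousLinearMap.adjoint R y)
      (w := y + starRingEnd ℂ z • ContinuousLinearMap.adjoint R y) fun x => by
        have h := congrArg (fun v => ⟪y, v⟫_ℂ) (hR.2 x)
        simp only [map_sub, map_smul, inner_sub_right, inner_smul_right] at h
        rw [inner_add_left, inner_smul_left, Complex.conj_conj,
          ContinuousLinearMap.adjoint_inner_left, ContinuousLinearMap.adjoint_inner_left, ← h]
        ring
    exact ⟨mem, by rw [apply_eq, add_sub_cancel_right]⟩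
  · intro φ
    refine ext_inner_right ℂ fun ψ => ?_
    have h := inner_apply_left_of_isSelfAdjoint hB φ ⟨R ψ, hR.mem_domain ψ⟩
    rw [hR.apply_map ψ] at h
    rw [ContinuousLinearMap.adjoint_inner_left, inner_sub_left, inner_smul_left,
      Complex.conj_conj, h, inner_add_right, inner_smul_right]
    ring

theorem isStarNormal (hB : IsSelfAdjoint B) (hR : IsResolventAt B z R) : IsStarNormal R :=
  ⟨(hR.star hB).commute hR⟩

end IsResolventAt

/-- The function `1 / (x - z)` of a real variable, replaced by `0` where its modulus exceeds
`c`. -/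
def cutoffResolvent (z : ℂ) (c : ℝ) (x : ℝ) : ℂ :=
  if 1 ≤ c * ‖(x : ℂ) - z‖ then ((x : ℂ) - z)⁻¹ else 0

theorem measurableSet_cutoff (z : ℂ) (c : ℝ) :
    MeasurableSet {x : ℝ | 1 ≤ c * ‖(x : ℂ) - z‖} :=
  measurableSet_le (by fun_prop) (by fun_prop)

theorem isBddMeasurable_cutoffResolvent (z : ℂ) {c : ℝ} (hc : 0 ≤ c) :
    IsBddMeasurable (cutoffResolvent z c) := by
  refine ⟨Measurable.ite (measurableSet_cutoff z c) (by fun_prop) measurable_const, c, fun x => ?_⟩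
  unfold cutoffResolvent
  split_ifs with h
  · have norm_pos : 0 < ‖(x : ℂ) - z‖ :=
      pos_of_mul_pos_right (zero_lt_one.trans_le h) hc
    rwa [norm_inv, inv_le_iff_one_le_mul₀ norm_pos]
  · simpa

/-- The real number `x` with `1 / (x - z) = y`, for `y` in the spectrum of a resolvent at `z`. -/
def resolventSymbolInv (z y : ℂ) : ℝ := (y⁻¹ + z).re

theorem IsResolventAt.resolventSymbolInv_sub (hB : IsSelfAdjoint B) (hR : IsResolventAt B z R)
    {y : ℂ} (hy : y ∈ spectrum ℂ R) (hy₀ : y ≠ 0) :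
    (resolventSymbolInv z y : ℂ) - z = y⁻¹ := by
  have hN := hR.isStarNormal hB
  have map_eq : cfcHom hN ((ContinuousMap.id ℂ).restrict (spectrum ℂ R) -
      star ((ContinuousMap.id ℂ).restrict (spectrum ℂ R))) =
      cfcHom hN ((z - starRingEnd ℂ z) • ((ContinuousMap.id ℂ).restrict (spectrum ℂ R) *
        star ((ContinuousMap.id ℂ).restrict (spectrum ℂ R)))) := by
    rw [map_sub, map_smul, map_mul, map_star, cfcHom_id hN]
    exact hR.sub_eq_smul_mul (hR.star hB)
  have sub_conj : y - starRingEnd ℂ y = (z - starRingEnd ℂ z) * (y * starRingEnd ℂ y) := by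
    simpa using congrArg (fun f : C(spectrum ℂ R, ℂ) => f ⟨y, hy⟩) (cfcHom_injective hN map_eq)
  have conj_ne_zero : starRingEnd ℂ y ≠ 0 := by simpa using hy₀
  have conj_eq : starRingEnd ℂ (y⁻¹ + z) = y⁻¹ + z := by
    rw [map_add, map_inv₀]
    field_simp
    linear_combination sub_conj
  rw [resolventSymbolInv, Complex.conj_eq_iff_re.1 conj_eq, add_sub_cancel_right]

theorem IsResolventAt.exists_integral_eq (hB : IsSelfAdjoint B) (hR : IsResolventAt B z R) :
    ∃ (E : ProjectionValuedMeasure H) (c : ℝ), 0 ≤ c ∧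
      (∀ φ, ∀ᵐ x : ℝ ∂(E.scalarMeasure φ), 1 ≤ c * ‖(x : ℂ) - z‖) ∧
      E.integral (cutoffResolvent z c) = R := by
  have hN := hR.isStarNormal hB
  obtain ⟨Φ, hΦ⟩ := exists_isBorelCalculus_cfcMeasure hN
  have measurable_inv : Measurable fun y : spectrum ℂ R => resolventSymbolInv z y := by
    unfold resolventSymbolInv
    fun_prop
  let E := hΦ.projectionValuedMeasure measurable_inv
  have scalarMeasure_eq (φ : H) : E.scalarMeasure φ = _ :=
    hΦ.scalarMeasure_projectionValuedMeasure measurable_inv φ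
  have ae_ne_zero := ae_ne_zero_cfcMeasure hN hR.injective
  let c := ‖R‖ * ‖(1 : H →L[ℂ] H)‖
  have hc : 0 ≤ c := by positivity
  have cutoff_le (y : spectrum ℂ R) (hy : (y : ℂ) ≠ 0) :
      1 ≤ c * ‖(resolventSymbolInv z y : ℂ) - z‖ := by
    rw [hR.resolventSymbolInv_sub hB y.2 hy, norm_inv, ← div_eq_mul_inv,
      one_le_div (norm_pos_iff.2 hy)]
    exact spectrum.norm_le_norm_mul_of_mem y.2
  refine ⟨E, c, hc, fun φ => ?_, ?_⟩
  · rw [scalarMeasure_eq, ae_map_iff measurable_inv.aemeasurable (measurableSet_cutoff z c)]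
    filter_upwards [ae_ne_zero φ] with y hy using cutoff_le y hy
  · have hb := isBddMeasurable_cutoffResolvent z hc
    refine E.isFormCalculus_integral.map_eq hb fun φ => ?_
    rw [scalarMeasure_eq,
      integral_map measurable_inv.aemeasurable hb.measurable.aestronglyMeasurable,
      hasForm_coe_cfcMeasure hN φ]
    refine integral_congr_ae ?_
    filter_upwards [ae_ne_zero φ] with y hy
    rw [cutoffResolvent, if_pos (cutoff_le y hy), hR.resolventSymbolInv_sub hB y.2 hy, inv_inv]

end SelfAdjoint

end Resolvent

/-! ### The spectral theorem -/

section SpectralTheorem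

variable {H : Type*} [NormedAddCommGroup H] [InnerProductSpace ℂ H] [CompleteSpace H]
  {B : H →ₗ.[ℂ] H} {E : ProjectionValuedMeasure H} {f : ℝ → ℂ}

/-- The bounded function that is `x` on `[-n, n]` and `0` elsewhere. -/
def truncatedId (n : ℕ) : ℝ → ℂ := (Set.Icc (-n : ℝ) n).indicator fun x => (x : ℂ)

theorem isBddMeasurable_truncatedId (n : ℕ) : IsBddMeasurable (truncatedId n) := by
  refine ⟨Complex.measurable_ofReal.indicator measurableSet_Icc, n, fun x => ?_⟩
  by_cases hx : x ∈ Set.Icc (-n : ℝ) n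
  · rw [truncatedId, Set.indicator_of_mem hx, Complex.norm_real]
    exact abs_le.2 hx
  · rw [truncatedId, Set.indicator_of_notMem hx, norm_zero]
    positivity

theorem conj_truncatedId (n : ℕ) (x : ℝ) :
    starRingEnd ℂ (truncatedId n x) = truncatedId n x := by
  by_cases hx : x ∈ Set.Icc (-n : ℝ) n <;> simp [truncatedId, hx]

theorem indicator_mul_sub_truncatedId (n : ℕ) (f : ℝ → ℂ) (x : ℝ) :
    (Set.Icc (-n : ℝ) n).indicator (fun _ => 1) x * f x - truncatedId n x =
      (Set.Icc (-n : ℝ) n).indicator (fun x => f x - x) x := by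
  by_cases hx : x ∈ Set.Icc (-n : ℝ) n <;> simp [truncatedId, hx]

theorem truncatedId_mul_indicator {m n : ℕ} (hmn : n ≤ m) (x : ℝ) :
    truncatedId m x * (Set.Icc (-n : ℝ) n).indicator (fun _ => 1) x = truncatedId n x := by
  have subset : Set.Icc (-n : ℝ) n ⊆ Set.Icc (-m) m :=
    Set.Icc_subset_Icc (neg_le_neg (Nat.cast_le.2 hmn)) (Nat.cast_le.2 hmn)
  by_cases hx : x ∈ Set.Icc (-n : ℝ) n
  · simp only [truncatedId, Set.indicator_of_mem hx, Set.indicator_of_mem (subset hx), mul_one]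
  · simp only [truncatedId, Set.indicator_of_notMem hx, mul_zero]

theorem aecover_Icc_natCast (ν : Measure ℝ) : AECover ν atTop fun n : ℕ => Set.Icc (-n : ℝ) n :=
  aecover_Icc (tendsto_neg_atTop_atBot.comp tendsto_natCast_atTop_atTop)
    tendsto_natCast_atTop_atTop

theorem isBddMeasurable_indicator_Icc (n : ℕ) :
    IsBddMeasurable ((Set.Icc (-n : ℝ) n).indicator fun _ => (1 : ℂ)) :=
  (IsBddMeasurable.const 1).indicator measurableSet_Icc

namespace ProjectionValuedMeasure

variable (E)

theorem tendsto_proj_Icc_apply (φ : H) :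
    Tendsto (fun n : ℕ => E.proj (Set.Icc (-n : ℝ) n) φ) atTop (𝓝 φ) :=
  E.tendsto_proj_apply (fun _ => measurableSet_Icc) (fun x => by
    filter_upwards [tendsto_natCast_atTop_atTop.eventually_ge_atTop |x|] with n hn
    exact abs_le.1 hn) φ

theorem inner_integral_truncatedId_left (n : ℕ) (φ ψ : H) :
    ⟪E.integral (truncatedId n) φ, ψ⟫_ℂ = ⟪φ, E.integral (truncatedId n) ψ⟫_ℂ := by
  rw [← ContinuousLinearMap.adjoint_inner_right, ← ContinuousLinearMap.star_eq_adjoint,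
    ← E.isFormCalculus_integral.map_conj (isBddMeasurable_truncatedId n)]
  simp_rw [conj_truncatedId]

theorem enorm_sq_integral_truncatedId_le (n : ℕ) (φ : H) :
    ‖E.integral (truncatedId n) φ‖ₑ ^ 2 ≤ ∫⁻ x, ENNReal.ofReal (x ^ 2) ∂(E.scalarMeasure φ) := by
  rw [E.isBorelCalculus_integral.enorm_sq_map_apply (isBddMeasurable_truncatedId n)]
  refine lintegral_mono fun x => ?_
  by_cases hx : x ∈ Set.Icc (-n : ℝ) n
  · rw [truncatedId, Set.indicator_of_mem hx, ← ofReal_norm, ← ENNReal.ofReal_pow (norm_nonneg _),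
      Complex.norm_real, Real.norm_eq_abs, sq_abs]
  · simp [truncatedId, Set.indicator_of_notMem hx]

theorem integrable_ofReal {φ : H}
    (hφ : ∫⁻ x, ENNReal.ofReal (x ^ 2) ∂(E.scalarMeasure φ) < ∞) :
    Integrable (fun x : ℝ => (x : ℂ)) (E.scalarMeasure φ) := by
  have sq_integrable : Integrable (fun x : ℝ => x ^ 2) (E.scalarMeasure φ) :=
    ⟨by fun_prop, (hasFiniteIntegral_iff_ofReal (Eventually.of_forall sq_nonneg)).2 hφ⟩
  exact (((memLp_two_iff_integrable_sq (by fun_prop)).2 sq_integrable).integrable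
    one_le_two).ofReal

theorem tendsto_inner_self_integral_truncatedId {φ : H}
    (hφ : ∫⁻ x, ENNReal.ofReal (x ^ 2) ∂(E.scalarMeasure φ) < ∞) :
    Tendsto (fun n => ⟪φ, E.integral (truncatedId n) φ⟫_ℂ) atTop
      (𝓝 (∫ x, (x : ℂ) ∂(E.scalarMeasure φ))) := by
  have h := (aecover_Icc_natCast (E.scalarMeasure φ)).integral_tendsto_of_countably_generated
    (E.integrable_ofReal hφ)
  refine h.congr fun n => ?_
  rw [E.isFormCalculus_integral.hasForm (isBddMeasurable_truncatedId n) φ, truncatedId,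
    integral_indicator measurableSet_Icc]

end ProjectionValuedMeasure

/-- The truncations of `B` are those of the spectral integral `∫ λ dE_λ`. For a self-adjoint `B`
this is equivalent to `IsSpectralMeasure B E`, and it involves only bounded operators. -/
def HasSpectralTruncations (B : H →ₗ.[ℂ] H) (E : ProjectionValuedMeasure H) : Prop :=
  ∀ (n : ℕ) (χ : B.domain),
    E.proj (Set.Icc (-n : ℝ) n) (B χ) = E.integral (truncatedId n) (χ : H)

namespace HasSpectralTruncations

theorem enorm_sq_integral_sub (hE : HasSpectralTruncations B E) (hf : IsBddMeasurable f)
    (φ : B.domain) :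
    ‖E.integral f (φ : H) - B φ‖ₑ ^ 2 = ∫⁻ x : ℝ, ‖f x - x‖ₑ ^ 2 ∂(E.scalarMeasure φ) := by
  have proj_sub_eq (n : ℕ) : E.proj (Set.Icc (-n : ℝ) n) (E.integral f (φ : H) - B φ) =
      E.integral (fun x => (Set.Icc (-n : ℝ) n).indicator (fun x => f x - x) x) (φ : H) := by
    have hind := isBddMeasurable_indicator_Icc n
    simp_rw [← indicator_mul_sub_truncatedId]
    rw [E.isFormCalculus_integral.map_sub (hind.mul hf) (isBddMeasurable_truncatedId n),
      E.isBorelCalculus_integral.map_mul hind hf, sub_apply, mul_apply_eq_comp, map_sub, hE,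
      E.integral_indicator_one measurableSet_Icc]
  have enorm_proj (n : ℕ) : ‖E.proj (Set.Icc (-n : ℝ) n) (E.integral f (φ : H) - B φ)‖ₑ ^ 2 =
      ∫⁻ x in Set.Icc (-n : ℝ) n, ‖f x - x‖ₑ ^ 2 ∂(E.scalarMeasure φ) := by
    have hb : IsBddMeasurable ((Set.Icc (-n : ℝ) n).indicator fun x => f x - x) := by
      rw [← funext (indicator_mul_sub_truncatedId n f)]
      exact ((isBddMeasurable_indicator_Icc n).mul hf).sub
        (isBddMeasurable_truncatedId n)
    rw [proj_sub_eq, E.isBorelCalculus_integral.enorm_sq_map_apply hb,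
      ← lintegral_indicator measurableSet_Icc]
    refine lintegral_congr fun x => ?_
    by_cases hx : x ∈ Set.Icc (-n : ℝ) n <;> simp [hx]
  have tendsto_left := ((ENNReal.continuous_pow 2).comp continuous_enorm).tendsto _ |>.comp
    (E.tendsto_proj_Icc_apply (E.integral f (φ : H) - B φ))
  refine tendsto_nhds_unique tendsto_left ?_
  have hfm := hf.measurable
  refine ((aecover_Icc_natCast _).lintegral_tendsto_of_countably_generated
    (by fun_prop)).congr fun n => (enorm_proj n).symm

theorem lintegral_sq_lt_top (hE : HasSpectralTruncations B E) (φ : B.domain) :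
    ∫⁻ x, ENNReal.ofReal (x ^ 2) ∂(E.scalarMeasure φ) < ∞ := by
  have h := hE.enorm_sq_integral_sub (.const 0) φ
  have enorm_sq (x : ℝ) : ‖(0 : ℂ) - x‖ₑ ^ 2 = ENNReal.ofReal (x ^ 2) := by
    rw [zero_sub, enorm_neg, ← ofReal_norm, ← ENNReal.ofReal_pow (norm_nonneg _),
      Complex.norm_real, Real.norm_eq_abs, sq_abs]
  simp_rw [enorm_sq] at h
  rw [← h]
  exact ENNReal.pow_lt_top enorm_lt_top

theorem mem_domain (hB : IsSelfAdjoint B) (hE : HasSpectralTruncations B E) {φ : H}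
    (hφ : ∫⁻ x, ENNReal.ofReal (x ^ 2) ∂(E.scalarMeasure φ) < ∞) : φ ∈ B.domain := by
  have mem_adjoint : φ ∈ B.adjoint.domain := by
    refine (B.mem_adjoint_domain_iff φ).2 (AddMonoidHomClass.continuous_of_bound _
      (√(∫⁻ x, ENNReal.ofReal (x ^ 2) ∂(E.scalarMeasure φ)).toReal) fun χ => ?_)
    refine le_of_tendsto (tendsto_const_nhds.inner (𝕜 := ℂ) (E.tendsto_proj_Icc_apply (B χ))).norm
      (Eventually.of_forall fun n => ?_)
    have norm_le : ‖E.integral (truncatedId n) φ‖ ≤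
        √(∫⁻ x, ENNReal.ofReal (x ^ 2) ∂(E.scalarMeasure φ)).toReal := by
      have h := ENNReal.toReal_mono hφ.ne (E.enorm_sq_integral_truncatedId_le n φ)
      rw [ENNReal.toReal_pow, toReal_enorm] at h
      exact Real.le_sqrt_of_sq_le h
    calc ‖⟪φ, E.proj (Set.Icc (-n : ℝ) n) (B χ)⟫_ℂ‖
        = ‖⟪E.integral (truncatedId n) φ, (χ : H)⟫_ℂ‖ := by
          rw [hE, E.inner_integral_truncatedId_left]
      _ ≤ ‖E.integral (truncatedId n) φ‖ * ‖(χ : H)‖ := norm_inner_le_norm _ _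
      _ ≤ _ := mul_le_mul_of_nonneg_right norm_le (norm_nonneg (χ : H))
  rwa [LinearPMap.isSelfAdjoint_def.1 hB] at mem_adjoint

theorem isSpectralMeasure (hB : IsSelfAdjoint B) (hE : HasSpectralTruncations B E) :
    IsSpectralMeasure B E := by
  refine ⟨fun φ => ⟨fun hφ => hE.lintegral_sq_lt_top ⟨φ, hφ⟩, hE.mem_domain hB⟩, fun φ => ?_⟩
  have h := (tendsto_const_nhds (x := (φ : H))).inner (𝕜 := ℂ) (E.tendsto_proj_Icc_apply (B φ))
  refine tendsto_nhds_unique (h.congr fun n => by rw [hE])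
    (E.tendsto_inner_self_integral_truncatedId (hE.lintegral_sq_lt_top φ))

end HasSpectralTruncations

theorem ofReal_mul_cutoffResolvent {z : ℂ} {c x : ℝ} (hx : 1 ≤ c * ‖(x : ℂ) - z‖) :
    (x : ℂ) * cutoffResolvent z c x = 1 + z * cutoffResolvent z c x := by
  have sub_ne_zero : (x : ℂ) - z ≠ 0 := fun h => by
    rw [h, norm_zero, mul_zero] at hx
    exact absurd hx (by norm_num)
  rw [cutoffResolvent, if_pos hx]
  field_simp
  ring

theorem IsResolventAt.hasSpectralTruncations {z : ℂ} {R : H →L[ℂ] H} (hR : IsResolventAt B z R)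
    {c : ℝ} (hc : 0 ≤ c) (hae : ∀ φ, ∀ᵐ x : ℝ ∂(E.scalarMeasure φ), 1 ≤ c * ‖(x : ℂ) - z‖)
    (hER : E.integral (cutoffResolvent z c) = R) : HasSpectralTruncations B E := by
  intro n χ
  have hb := isBddMeasurable_cutoffResolvent z hc
  have hone_add := (IsBddMeasurable.const (X := ℝ) 1).add ((IsBddMeasurable.const z).mul hb)
  have hind := isBddMeasurable_indicator_Icc n
  have hid := isBddMeasurable_truncatedId n
  obtain ⟨η, rfl⟩ : ∃ η, χ = ⟨R η, hR.mem_domain η⟩ := ⟨_, Subtype.ext (hR.2 χ).symm⟩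
  have one_add_smul : (1 : H →L[ℂ] H) + z • R =
      E.integral fun x => 1 + z * cutoffResolvent z c x := by
    rw [E.isFormCalculus_integral.map_add (.const 1) ((IsBddMeasurable.const z).mul hb),
      E.isFormCalculus_integral.map_const_mul z hb, E.isFormCalculus_integral.map_one, hER]
  have apply_eq : B ⟨R η, hR.mem_domain η⟩ = ((1 : H →L[ℂ] H) + z • R) η := hR.apply_map η
  rw [apply_eq, ← E.integral_indicator_one measurableSet_Icc, one_add_smul, ← mul_apply_eq_comp,
    ← E.isBorelCalculus_integral.map_mul hind hone_add]
  change _ = E.integral (truncatedId n) (R η)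
  rw [← hER, ← mul_apply_eq_comp, ← E.isBorelCalculus_integral.map_mul hid hb]
  congr 1
  refine E.isFormCalculus_integral.map_eq (hind.mul hone_add) fun φ => ?_
  rw [E.isFormCalculus_integral.hasForm (hid.mul hb) φ]
  refine integral_congr_ae ?_
  filter_upwards [hae φ] with x hx
  by_cases hxn : x ∈ Set.Icc (-n : ℝ) n
  · simp only [truncatedId, Set.indicator_of_mem hxn, one_mul, ofReal_mul_cutoffResolvent hx]
  · simp only [truncatedId, Set.indicator_of_notMem hxn, zero_mul]

theorem isSpectralMeasure_spectralMeasure (hB : IsSelfAdjoint B) {z : ℂ}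
    (hz : z ∈ resolventSet B) : IsSpectralMeasure B (spectralMeasure B) := by
  obtain ⟨R, hR⟩ := hz
  obtain ⟨E, c, hc, hae, hER⟩ := hR.exists_integral_eq hB
  have h : ∃ E, IsSpectralMeasure B E :=
    ⟨E, (hR.hasSpectralTruncations hc hae hER).isSpectralMeasure hB⟩
  rw [spectralMeasure, dif_pos h]
  exact h.choose_spec

namespace IsSpectralMeasure

theorem integral_apply_mem_domain (hE : IsSpectralMeasure B E) (hf : IsBddMeasurable f) {φ : H}
    (hφ : φ ∈ B.domain) : E.integral f φ ∈ B.domain := by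
  obtain ⟨c, hc⟩ := hf.bounded
  have hfm := hf.measurable
  rw [hE.1] at hφ ⊢
  calc ∫⁻ x, ENNReal.ofReal (x ^ 2) ∂(E.scalarMeasure (E.integral f φ))
      = ∫⁻ x, ‖f x‖ₑ ^ 2 * ENNReal.ofReal (x ^ 2) ∂(E.scalarMeasure φ) := by
        rw [E.scalarMeasure_integral_apply hf,
          lintegral_withDensity_eq_lintegral_mul _ (by fun_prop) (by fun_prop)]
        rfl
    _ ≤ ∫⁻ x, ENNReal.ofReal c ^ 2 * ENNReal.ofReal (x ^ 2) ∂(E.scalarMeasure φ) := by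
        gcongr with x
        rw [← ofReal_norm]
        exact ENNReal.ofReal_le_ofReal (hc x)
    _ = ENNReal.ofReal c ^ 2 * ∫⁻ x, ENNReal.ofReal (x ^ 2) ∂(E.scalarMeasure φ) :=
        lintegral_const_mul _ (by fun_prop)
    _ < ∞ := ENNReal.mul_lt_top (ENNReal.pow_lt_top ENNReal.ofReal_lt_top) hφ

theorem tendsto_inner_integral_truncatedId (hE : IsSpectralMeasure B E) (ψ φ : B.domain) :
    Tendsto (fun n => ⟪(ψ : H), E.integral (truncatedId n) φ⟫_ℂ) atTop (𝓝 ⟪(ψ : H), B φ⟫_ℂ) :=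
  tendsto_inner_map_inner_map_of_forall_self (S := B.domain.subtype)
    (T := fun n => (E.integral (truncatedId n) : H →ₗ[ℂ] H) ∘ₗ B.domain.subtype) (T₀ := B.toFun)
    (fun χ => by
      have h := E.tendsto_inner_self_integral_truncatedId ((hE.1 χ).1 χ.2)
      rwa [← hE.2 χ] at h) ψ φ

theorem apply_integral_apply (hE : IsSpectralMeasure B E) (hd : Dense (B.domain : Set H))
    (hf : IsBddMeasurable f) (φ : B.domain) :
    B ⟨E.integral f φ, hE.integral_apply_mem_domain hf φ.2⟩ = E.integral f (B φ) := by
  refine hd.eq_of_inner_right (𝕜 := ℂ) fun ψ hψ => ?_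
  have hconj : E.integral (fun x => starRingEnd ℂ (f x)) =
      ContinuousLinearMap.adjoint (E.integral f) :=
    E.isFormCalculus_integral.map_conj hf
  have tendsto_left := hE.tendsto_inner_integral_truncatedId ⟨ψ, hψ⟩
    ⟨E.integral f φ, hE.integral_apply_mem_domain hf φ.2⟩
  have tendsto_right := hE.tendsto_inner_integral_truncatedId
    ⟨_, hE.integral_apply_mem_domain hf.conj hψ⟩ φ
  simp only [hconj, ContinuousLinearMap.adjoint_inner_left] at tendsto_right
  refine tendsto_nhds_unique tendsto_left (tendsto_right.congr fun n => ?_)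
  rw [← mul_apply_eq_comp, ← mul_apply_eq_comp,
    ← E.isBorelCalculus_integral.map_mul hf (isBddMeasurable_truncatedId n),
    ← E.isBorelCalculus_integral.map_mul (isBddMeasurable_truncatedId n) hf]
  simp_rw [mul_comm]

theorem commute_resolvent (hE : IsSpectralMeasure B E) (hd : Dense (B.domain : Set H))
    (hf : IsBddMeasurable f) {z : ℂ} {R : H →L[ℂ] H} (hR : IsResolventAt B z R) :
    Commute R (E.integral f) := by
  rw [commute_iff_eq]
  ext ψ
  have h := hR.2 ⟨_, hE.integral_apply_mem_domain hf (hR.mem_domain ψ)⟩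
  rw [hE.apply_integral_apply hd hf ⟨_, hR.mem_domain ψ⟩, hR.apply_map] at h
  simpa only [mul_apply_eq_comp, map_add, map_smul, add_sub_cancel_right] using h

theorem hasSpectralTruncations (hE : IsSpectralMeasure B E) (hd : Dense (B.domain : Set H)) :
    HasSpectralTruncations B E := fun n χ => by
  have hind := isBddMeasurable_indicator_Icc n
  rw [← E.integral_indicator_one measurableSet_Icc, ← hE.apply_integral_apply hd hind]
  refine hd.eq_of_inner_right (𝕜 := ℂ) fun ψ hψ => ?_
  refine tendsto_nhds_unique (hE.tendsto_inner_integral_truncatedId ⟨ψ, hψ⟩ _)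
    (tendsto_const_nhds.congr' ?_)
  filter_upwards [eventually_ge_atTop n] with m hm
  rw [← mul_apply_eq_comp,
    ← E.isBorelCalculus_integral.map_mul (isBddMeasurable_truncatedId m) hind]
  simp_rw [truncatedId_mul_indicator hm]

end IsSpectralMeasure

end SpectralTheorem

/-! ### Unitary groups -/

section UnitaryGroup

variable {H : Type*} [NormedAddCommGroup H] [InnerProductSpace ℂ H] [CompleteSpace H]
  {B : H →ₗ.[ℂ] H}

theorem norm_exp_I_mul_mul (x t : ℝ) : ‖Complex.exp (Complex.I * x * t)‖ = 1 := by
  rw [mul_assoc, ← Complex.ofReal_mul, Complex.norm_exp_I_mul_ofReal]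

theorem isBddMeasurable_exp (t : ℝ) :
    IsBddMeasurable fun x : ℝ => Complex.exp (Complex.I * x * t) :=
  ⟨by fun_prop, 1, fun x => (norm_exp_I_mul_mul x t).le⟩

theorem boundedlyTendsto_exp (t : ℝ) :
    BoundedlyTendsto (fun s x : ℝ => Complex.exp (Complex.I * x * s)) (𝓝 t)
      fun x => Complex.exp (Complex.I * x * t) where
  measurable s := (isBddMeasurable_exp s).measurable
  bounded := ⟨1, fun s x => (norm_exp_I_mul_mul x s).le⟩
  tendsto x := Continuous.tendsto (by fun_prop) t

namespace ProjectionValuedMeasure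

variable (E : ProjectionValuedMeasure H)

/-- The unitary group `∫ e^{iλt} dE_λ`. -/
def group (t : ℝ) : H →L[ℂ] H := E.integral fun x => Complex.exp (Complex.I * x * t)

theorem group_add (s t : ℝ) : E.group (s + t) = E.group s * E.group t := by
  rw [group, group, group,
    ← E.isBorelCalculus_integral.map_mul (isBddMeasurable_exp s) (isBddMeasurable_exp t)]
  simp_rw [← Complex.exp_add, Complex.ofReal_add, mul_add]

theorem group_add_apply (s t : ℝ) (φ : H) : E.group (s + t) φ = E.group s (E.group t φ) := by
  rw [E.group_add, mul_apply_eq_comp]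

theorem group_zero : E.group 0 = 1 := by
  simpa only [group, Complex.ofReal_zero, mul_zero, Complex.exp_zero] using
    E.isFormCalculus_integral.map_one

theorem adjoint_group (t : ℝ) : ContinuousLinearMap.adjoint (E.group t) = E.group (-t) := by
  rw [group, group, ← ContinuousLinearMap.star_eq_adjoint,
    ← E.isFormCalculus_integral.map_conj (isBddMeasurable_exp t)]
  simp_rw [← Complex.exp_conj]
  simp

theorem inner_group_left (t : ℝ) (φ ψ : H) : ⟪E.group t φ, ψ⟫_ℂ = ⟪φ, E.group (-t) ψ⟫_ℂ := by
  rw [← E.adjoint_group, ContinuousLinearMap.adjoint_inner_right]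

theorem norm_group_apply (t : ℝ) (φ : H) : ‖E.group t φ‖ = ‖φ‖ := by
  have inner_self : ⟪E.group t φ, E.group t φ⟫_ℂ = ⟪φ, φ⟫_ℂ := by
    rw [E.inner_group_left, ← E.group_add_apply, neg_add_cancel, E.group_zero, one_apply_eq_self]
  rw [norm_eq_sqrt_re_inner (𝕜 := ℂ), inner_self, ← norm_eq_sqrt_re_inner]

theorem continuous_group_apply (φ : H) : Continuous fun t => E.group t φ :=
  continuous_iff_continuousAt.2 fun t =>
    E.isBorelCalculus_integral.tendsto_map_apply (boundedlyTendsto_exp t) φ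

end ProjectionValuedMeasure

/-- The difference quotient at `0` of `t ↦ e^{ixt}`, divided by `i`, as a function of `x`. -/
def expQuotient (t x : ℝ) : ℂ := (Complex.I * t)⁻¹ * (Complex.exp (Complex.I * x * t) - 1)

theorem isBddMeasurable_expQuotient (t : ℝ) : IsBddMeasurable (expQuotient t) :=
  (IsBddMeasurable.const _).mul ((isBddMeasurable_exp t).sub (.const 1))

theorem norm_expQuotient_le (t x : ℝ) : ‖expQuotient t x‖ ≤ |x| := by
  have exp_sub_one_le : ‖Complex.exp (Complex.I * x * t) - 1‖ ≤ |x| * |t| := by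
    have h := Real.norm_exp_I_mul_ofReal_sub_one_le (x := x * t)
    rwa [Real.norm_eq_abs, abs_mul, Complex.ofReal_mul, ← mul_assoc] at h
  rcases eq_or_ne t 0 with rfl | ht
  · simp [expQuotient]
  · have := abs_pos.2 ht
    rw [expQuotient, norm_mul, norm_inv, norm_mul, Complex.norm_I, one_mul, Complex.norm_real,
      Real.norm_eq_abs]
    calc |t|⁻¹ * ‖Complex.exp (Complex.I * x * t) - 1‖ ≤ |t|⁻¹ * (|x| * |t|) := by gcongr
      _ = |x| := by field_simp

theorem enorm_expQuotient_sub_sq_le (t x : ℝ) :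
    ‖expQuotient t x - x‖ₑ ^ 2 ≤ 4 * ENNReal.ofReal (x ^ 2) := by
  have norm_le : ‖expQuotient t x - x‖ ≤ 2 * |x| := by
    refine (norm_sub_le _ _).trans ?_
    rw [Complex.norm_real, Real.norm_eq_abs]
    linarith [norm_expQuotient_le t x]
  calc ‖expQuotient t x - x‖ₑ ^ 2 ≤ ENNReal.ofReal (2 * |x|) ^ 2 := by
        rw [← ofReal_norm]
        gcongr
    _ = 4 * ENNReal.ofReal (x ^ 2) := by
        rw [← ENNReal.ofReal_pow (by positivity), mul_pow, sq_abs,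
          ENNReal.ofReal_mul (by positivity)]
        norm_num

theorem tendsto_expQuotient (x : ℝ) :
    Tendsto (fun t => expQuotient t x) (𝓝[≠] 0) (𝓝 (x : ℂ)) := by
  have hasDerivAt_exp : HasDerivAt (fun t : ℝ => Complex.exp (Complex.I * x * t))
      (Complex.I * x) 0 := by
    simpa using ((hasDerivAt_id (0 : ℝ)).ofReal_comp.const_mul (Complex.I * x)).cexp
  have h := hasDerivAt_exp.tendsto_slope_zero.const_mul (-Complex.I)
  rw [← mul_assoc, neg_mul, Complex.I_mul_I, neg_neg, one_mul] at h
  refine h.congr fun t => ?_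
  simp only [expQuotient, zero_add, Complex.ofReal_zero, mul_zero, Complex.exp_zero,
    Complex.real_smul, mul_inv, Complex.inv_I, Complex.ofReal_inv, mul_assoc]

namespace HasSpectralTruncations

variable {E : ProjectionValuedMeasure H} (hE : HasSpectralTruncations B E)

include hE

theorem tendsto_integral_expQuotient (φ : B.domain) :
    Tendsto (fun t => E.integral (expQuotient t) (φ : H)) (𝓝[≠] 0) (𝓝 (B φ)) := by
  have lintegral_tendsto : Tendsto (fun t => ∫⁻ x : ℝ, ‖expQuotient t x - x‖ₑ ^ 2
      ∂(E.scalarMeasure φ)) (𝓝[≠] 0) (𝓝 (∫⁻ _, 0 ∂(E.scalarMeasure φ))) := by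
    refine tendsto_lintegral_filter_of_dominated_convergence _ (Eventually.of_forall fun t => ?_)
      (Eventually.of_forall fun t => Eventually.of_forall (enorm_expQuotient_sub_sq_le t)) ?_
      (Eventually.of_forall fun x => ?_)
    · have := (isBddMeasurable_expQuotient t).measurable
      fun_prop
    · rw [lintegral_const_mul _ (by fun_prop)]
      exact (ENNReal.mul_lt_top (by simp) (hE.lintegral_sq_lt_top φ)).ne
    · have h := (ENNReal.continuous_pow 2).tendsto _ |>.comp
        ((tendsto_expQuotient x).sub_const (x : ℂ)).enorm
      simpa [Function.comp_def] using h
  have enorm_tendsto := (ENNReal.continuous_rpow_const (y := ((2 : ℕ) : ℝ)⁻¹)).tendsto _ |>.comp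
    lintegral_tendsto
  rw [tendsto_iff_edist_tendsto_0]
  refine (enorm_tendsto.congr fun t => ?_).trans_eq (by simp)
  rw [Function.comp_apply, ← hE.enorm_sq_integral_sub (isBddMeasurable_expQuotient t),
    ENNReal.pow_rpow_inv_natCast two_ne_zero, edist_eq_enorm_sub]

theorem hasDerivAt_group_apply (φ : B.domain) (t : ℝ) :
    HasDerivAt (fun s => E.group s (φ : H)) (Complex.I • E.group t (B φ)) t := by
  have at_zero : HasDerivAt (fun s => E.group s (φ : H)) (Complex.I • B φ) 0 := by
    rw [hasDerivAt_iff_tendsto_slope_zero]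
    refine ((hE.tendsto_integral_expQuotient φ).const_smul Complex.I).congr fun s => ?_
    have integral_expQuotient : E.integral (expQuotient s) =
        (Complex.I * s)⁻¹ • (E.group s - 1) := by
      rw [ProjectionValuedMeasure.group, ← E.isFormCalculus_integral.map_one,
        ← E.isFormCalculus_integral.map_sub (isBddMeasurable_exp s) (.const 1),
        ← E.isFormCalculus_integral.map_const_mul _ ((isBddMeasurable_exp s).sub (.const 1))]
      rfl
    rw [integral_expQuotient]
    simp only [smul_apply, sub_apply, one_apply_eq_self, zero_add, E.group_zero, smul_smul,
      mul_inv, ← mul_assoc, mul_inv_cancel₀ Complex.I_ne_zero, one_mul, ← Complex.ofReal_inv,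
      Complex.coe_smul]
  rw [← map_smul]
  have shifted : HasDerivAt (fun s => E.group (s - t) (φ : H)) (Complex.I • B φ) t :=
    HasDerivAt.comp_sub_const t t (by rwa [sub_self])
  have h := ((E.group t).restrictScalars ℝ).hasFDerivAt.comp_hasDerivAt t shifted
  refine h.congr_of_eventuallyEq (Eventually.of_forall fun s => ?_)
  simp [← E.group_add_apply]

end HasSpectralTruncations

end UnitaryGroup

/-! ### The absolutely continuous subspace -/

section AbsolutelyContinuous

variable {H : Type*} [NormedAddCommGroup H] [InnerProductSpace ℂ H] [CompleteSpace H]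
  {B : H →ₗ.[ℂ] H}

theorem exists_measurable_eq_withDensity_coe {X : Type*} [MeasurableSpace X] {μ ν : Measure X}
    [SigmaFinite μ] [SigmaFinite ν] (h : μ ≪ ν) :
    ∃ w : X → ℝ≥0, Measurable w ∧ μ = ν.withDensity fun x => w x := by
  refine ⟨fun x => (μ.rnDeriv ν x).toNNReal, (μ.measurable_rnDeriv ν).ennreal_toNNReal, ?_⟩
  conv_lhs => rw [← Measure.withDensity_rnDeriv_eq μ ν h]
  exact withDensity_congr_ae ((μ.rnDeriv_lt_top ν).mono fun x hx =>
    (ENNReal.coe_toNNReal hx.ne).symm)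

namespace ProjectionValuedMeasure

variable (E : ProjectionValuedMeasure H) {φ : H}

theorem integral_apply_mem_acSubspace {f : ℝ → ℂ} (hf : IsBddMeasurable f)
    (hφ : φ ∈ E.acSubspace) : E.integral f φ ∈ E.acSubspace := by
  have h : E.scalarMeasure (E.integral f φ) ≪ E.scalarMeasure φ := by
    rw [E.scalarMeasure_integral_apply hf]
    exact withDensity_absolutelyContinuous _ _
  exact h.trans hφ

theorem group_apply_mem_acSubspace (t : ℝ) (hφ : φ ∈ E.acSubspace) :
    E.group t φ ∈ E.acSubspace :=
  E.integral_apply_mem_acSubspace (isBddMeasurable_exp t) hφ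

theorem acProj_apply_mem (φ : H) : E.acProj φ ∈ E.acSubspace :=
  E.acSubspace.starProjection_apply_mem φ

theorem inner_acProj_left (x : H) (hφ : φ ∈ E.acSubspace) : ⟪E.acProj x, φ⟫_ℂ = ⟪x, φ⟫_ℂ := by
  rw [acProj, Submodule.inner_starProjection_left_eq_right,
    Submodule.starProjection_eq_self_iff.2 hφ]

theorem scalarMeasure_proj_apply (φ : H) {S : Set ℝ} (hS : MeasurableSet S) :
    E.scalarMeasure (E.proj S φ) = (E.scalarMeasure φ).restrict S := by
  ext S' hS'
  rw [Measure.restrict_apply hS', ← E.enorm_sq_proj _ hS', ← E.enorm_sq_proj _ (hS'.inter hS),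
    E.proj_inter _ _ hS' hS, mul_apply_eq_comp]

/-- The vectors `φ` with `d(φ, E_λ φ) = |f(λ)|² dλ` for some `f ∈ L^∞(ℝ)`. -/
def boundedDensity : Set H :=
  {φ | ∃ f : ℝ → ℂ, MemLp f ∞ volume ∧
    E.scalarMeasure φ = volume.withDensity fun x => ‖f x‖ₑ ^ 2}

theorem boundedDensity_subset_acSubspace : E.boundedDensity ⊆ E.acSubspace := by
  rintro φ ⟨f, -, hf⟩
  have h : E.scalarMeasure φ ≪ volume := hf ▸ withDensity_absolutelyContinuous _ _
  exact h

theorem mem_boundedDensity_iff : φ ∈ E.boundedDensity ↔ ∃ w : ℝ → ℝ≥0, Measurable w ∧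
    (∃ c, ∀ x, w x ≤ c) ∧ E.scalarMeasure φ = volume.withDensity fun x => w x := by
  constructor
  · rintro ⟨f, hf, h⟩
    have ae_le := ae_le_eLpNormEssSup (f := f) (μ := volume)
    rw [← eLpNorm_exponent_top] at ae_le
    refine ⟨fun x => min (‖hf.1.mk f x‖₊ ^ 2) ((eLpNorm f ∞ volume).toNNReal ^ 2),
      (hf.1.stronglyMeasurable_mk.measurable.nnnorm.pow_const 2).min measurable_const,
      ⟨_, fun x => min_le_right _ _⟩, h.trans (withDensity_congr_ae ?_)⟩
    filter_upwards [hf.1.ae_eq_mk, ae_le] with x hx hle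
    rw [← ENNReal.coe_toNNReal hf.eLpNorm_ne_top, enorm_le_coe] at hle
    rw [← hx, min_eq_left (pow_le_pow_left' hle 2), ENNReal.coe_pow, enorm_eq_nnnorm]
  · rintro ⟨w, hw, ⟨c, hc⟩, h⟩
    refine ⟨fun x => ((NNReal.sqrt (w x) : ℝ) : ℂ), memLp_top_of_bound
      (by fun_prop : Measurable fun x => ((NNReal.sqrt (w x) : ℝ) : ℂ)).aestronglyMeasurable
      (NNReal.sqrt c) (Eventually.of_forall fun x => ?_), ?_⟩
    · rw [Complex.norm_real, NNReal.norm_eq]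
      exact NNReal.coe_le_coe.2 (NNReal.sqrt_le_sqrt.2 (hc x))
    · rw [h]
      congr 1
      ext x
      rw [← ofReal_norm, Complex.norm_real, NNReal.norm_eq, ENNReal.ofReal_coe_nnreal,
        ← ENNReal.coe_pow, NNReal.sq_sqrt]

theorem proj_apply_mem_boundedDensity {w : ℝ → ℝ≥0} (hw : Measurable w)
    (h : E.scalarMeasure φ = volume.withDensity fun x => w x) (c : ℝ≥0) :
    E.proj {x | w x ≤ c} φ ∈ E.boundedDensity := by
  have hS : MeasurableSet {x | w x ≤ c} := measurableSet_le hw measurable_const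
  refine E.mem_boundedDensity_iff.2 ⟨{x | w x ≤ c}.indicator w, hw.indicator hS,
    ⟨c, fun x => Set.indicator_le' (fun x hx => hx) (fun _ _ => zero_le) x⟩, ?_⟩
  rw [E.scalarMeasure_proj_apply φ hS, h, restrict_withDensity hS, ← withDensity_indicator hS]
  simp_rw [ENNReal.coe_indicator]

theorem acSubspace_subset_closure_boundedDensity :
    (E.acSubspace : Set H) ⊆ closure E.boundedDensity := by
  intro φ hφ
  obtain ⟨w, hw, h⟩ := exists_measurable_eq_withDensity_coe hφ
  exact mem_closure_of_tendsto (E.tendsto_proj_apply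
    (S := fun n : ℕ => {x | w x ≤ n}) (fun n => measurableSet_le hw measurable_const)
    (fun x => tendsto_natCast_atTop_atTop.eventually_ge_atTop (w x)) φ)
    (Eventually.of_forall fun n => E.proj_apply_mem_boundedDensity hw h n)

/-- This is the Riemann–Lebesgue lemma for the density of the scalar spectral measure. -/
theorem tendsto_inner_self_group (hφ : φ ∈ E.acSubspace) :
    Tendsto (fun t : ℝ => ⟪φ, E.group (-t) φ⟫_ℂ) atTop (𝓝 0) := by
  have riemann_lebesgue := (Real.tendsto_integral_exp_smul_cocompact fun x =>
    ((((E.scalarMeasure φ).rnDeriv volume x).toReal : ℝ) : ℂ)).comp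
      ((tendsto_id.atTop_div_const Real.two_pi_pos).mono_right atTop_le_cocompact)
  refine riemann_lebesgue.congr fun t => ?_
  rw [group, E.isFormCalculus_integral.hasForm (isBddMeasurable_exp _),
    ← integral_rnDeriv_smul (show E.scalarMeasure φ ≪ volume from hφ)]
  refine MeasureTheory.integral_congr_ae (Eventually.of_forall fun x => ?_)
  simp only [id_eq, Circle.smul_def, Real.fourierChar_apply, smul_eq_mul, Complex.real_smul]
  rw [mul_comm]
  congr 2
  push_cast
  have : (Real.pi : ℂ) ≠ 0 := by exact_mod_cast Real.pi_ne_zero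
  field_simp

theorem tendsto_inner_group (x : H) (hφ : φ ∈ E.acSubspace) :
    Tendsto (fun t : ℝ => ⟪x, E.group (-t) φ⟫_ℂ) atTop (𝓝 0) := by
  have h := tendsto_inner_map_inner_map_of_forall_self (l := atTop) (S := E.acSubspace.subtype)
    (T := fun t : ℝ => (E.group (-t) : H →ₗ[ℂ] H) ∘ₗ E.acSubspace.subtype)
    (T₀ := 0) (fun y => by simpa using E.tendsto_inner_self_group y.2)
    ⟨E.acProj x, E.acProj_apply_mem x⟩ ⟨φ, hφ⟩
  rw [LinearMap.zero_apply, inner_zero_right] at h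
  exact h.congr fun t => E.inner_acProj_left x (E.group_apply_mem_acSubspace (-t) hφ)

end ProjectionValuedMeasure

theorem IsSpectralMeasure.resolvent_apply_mem_acSubspace {E : ProjectionValuedMeasure H}
    (hE : IsSpectralMeasure B E) (hd : Dense (B.domain : Set H)) {z : ℂ} {R : H →L[ℂ] H}
    (hR : IsResolventAt B z R) {φ : H} (hφ : φ ∈ E.acSubspace) : R φ ∈ E.acSubspace := by
  refine Measure.AbsolutelyContinuous.mk fun S hS hS₀ => ?_
  have proj_resolvent : E.proj S (R φ) = R (E.proj S φ) := by
    rw [← E.integral_indicator_one hS]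
    exact congrArg (· φ)
      (hE.commute_resolvent hd ((IsBddMeasurable.const 1).indicator hS) hR).eq.symm
  have proj_eq_zero : E.proj S φ = 0 := by
    rw [← enorm_eq_zero, ← sq_eq_zero_iff, E.enorm_sq_proj φ hS]
    exact hφ hS₀
  rw [← E.enorm_sq_proj _ hS, proj_resolvent, proj_eq_zero, map_zero, enorm_zero,
    zero_pow two_ne_zero]

theorem IsSpectralMeasure.acSubspace_subset_closure_image_resolvent {E : ProjectionValuedMeasure H}
    (hE : IsSpectralMeasure B E) (hd : Dense (B.domain : Set H)) {z : ℂ} {R : H →L[ℂ] H}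
    (hR : IsResolventAt B z R) : (E.acSubspace : Set H) ⊆ closure (R '' E.acSubspace) := by
  intro φ hφ
  let f (n : ℕ) (x : ℝ) : ℂ :=
    truncatedId n x - z * (Set.Icc (-n : ℝ) n).indicator (fun _ => 1) x
  have hind (n : ℕ) : IsBddMeasurable fun x =>
      z * (Set.Icc (-n : ℝ) n).indicator (fun _ => 1) x :=
    (IsBddMeasurable.const z).mul (isBddMeasurable_indicator_Icc n)
  have hf (n : ℕ) : IsBddMeasurable (f n) := (isBddMeasurable_truncatedId n).sub (hind n)
  have resolvent_integral (n : ℕ) : R (E.integral (f n) φ) = E.proj (Set.Icc (-n) n) φ := by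
    rw [← mul_apply_eq_comp, (hE.commute_resolvent hd (hf n) hR).eq, mul_apply_eq_comp,
      E.isFormCalculus_integral.map_sub (isBddMeasurable_truncatedId n) (hind n),
      E.isFormCalculus_integral.map_const_mul z (isBddMeasurable_indicator_Icc n),
      E.integral_indicator_one measurableSet_Icc, sub_apply, smul_apply,
      ← hE.hasSpectralTruncations hd n ⟨R φ, hR.mem_domain φ⟩, hR.apply_map, map_add, map_smul,
      add_sub_cancel_right]
  refine mem_closure_of_tendsto (E.tendsto_proj_Icc_apply φ) (Eventually.of_forall fun n => ?_)
  exact ⟨E.integral (f n) φ, E.integral_apply_mem_acSubspace (hf n) hφ, resolvent_integral n⟩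

end AbsolutelyContinuous

/-! ### Square integrability of matrix elements of unitary groups -/

section Plancherel

theorem enorm_sq_Lp {X F : Type*} [MeasurableSpace X] {μ : Measure X} [NormedAddCommGroup F]
    (f : Lp F 2 μ) : ‖f‖ₑ ^ 2 = ∫⁻ x, ‖f x‖ₑ ^ 2 ∂μ := by
  rw [Lp.enorm_def, eLpNorm_eq_lintegral_rpow_enorm_toReal (by norm_num) (by norm_num)]
  simp only [ENNReal.toReal_ofNat, ENNReal.rpow_ofNat, one_div]
  rw [← ENNReal.rpow_natCast, ← ENNReal.rpow_mul]
  norm_num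

theorem integral_smul_fourier_toLp {h : ℝ → ℂ} (h1 : Integrable h) (h2 : MemLp h 2 volume)
    (g : SchwartzMap ℝ ℂ) :
    ∫ x, g x • (𝓕 (h2.toLp h) : Lp ℂ 2 (volume : Measure ℝ)) x = ∫ x, g x • 𝓕 h x := by
  have distribution_eq := congrArg (fun D => D g)
    (Lp.fourier_toTemperedDistribution_eq (h2.toLp h))
  simp only [TemperedDistribution.fourier_apply, Lp.toTemperedDistribution_apply]
    at distribution_eq
  have self_adjoint := VectorFourier.integral_fourierIntegral_smul_eq_flip (L := innerₗ ℝ)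
    (μ := volume) (ν := volume) Real.continuous_fourierChar (by exact continuous_inner)
    g.integrable h1
  rw [flip_innerₗ] at self_adjoint
  refine distribution_eq.symm.trans (Eq.trans (integral_congr_ae ?_) self_adjoint)
  filter_upwards [h2.coeFn_toLp] with x hx
  rw [hx]
  rfl

theorem fourier_ae_eq_fourier_toLp {h : ℝ → ℂ} (h1 : Integrable h) (h2 : MemLp h 2 volume) :
    𝓕 h =ᵐ[volume] (𝓕 (h2.toLp h) : Lp ℂ 2 (volume : Measure ℝ)) := by
  have continuous_fourier : Continuous (𝓕 h) := VectorFourier.fourierIntegral_continuous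
    Real.continuous_fourierChar (by exact continuous_inner) h1
  refine ae_eq_of_integral_contDiff_smul_eq continuous_fourier.locallyIntegrable
    ((Lp.memLp _).locallyIntegrable (by norm_num)) fun g hg hgc => ?_
  exact (integral_smul_fourier_toLp h1 h2 ((hgc.comp_left Complex.ofReal_zero).toSchwartzMap
    (Complex.ofRealCLM.contDiff.comp hg))).symm

theorem lintegral_enorm_sq_fourier {h : ℝ → ℂ} (h1 : Integrable h) (h2 : MemLp h 2 volume) :
    ∫⁻ ξ, ‖𝓕 h ξ‖ₑ ^ 2 = ∫⁻ t, ‖h t‖ₑ ^ 2 := by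
  have enorm_eq : ‖(𝓕 (h2.toLp h) : Lp ℂ 2 (volume : Measure ℝ))‖ₑ = ‖h2.toLp h‖ₑ := by
    rw [← ofReal_norm, Lp.norm_fourier_eq, ofReal_norm]
  calc ∫⁻ ξ, ‖𝓕 h ξ‖ₑ ^ 2
      = ∫⁻ ξ, ‖(𝓕 (h2.toLp h) : Lp ℂ 2 (volume : Measure ℝ)) ξ‖ₑ ^ 2 :=
        lintegral_congr_ae ((fourier_ae_eq_fourier_toLp h1 h2).mono fun x hx => by simp only [hx])
    _ = ∫⁻ t, ‖h2.toLp h t‖ₑ ^ 2 := by rw [← enorm_sq_Lp, enorm_eq, enorm_sq_Lp]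
    _ = ∫⁻ t, ‖h t‖ₑ ^ 2 := lintegral_congr_ae (h2.coeFn_toLp.mono fun x hx => by simp only [hx])

theorem integral_mul_exp_neg_eq_fourier (h : ℝ → ℂ) (t : ℝ) :
    ∫ x : ℝ, h x * Complex.exp (Complex.I * x * ((-t : ℝ) : ℂ)) = 𝓕 h (t * (2 * Real.pi)⁻¹) := by
  rw [Real.fourier_eq]
  congr 1
  ext x
  rw [Circle.smul_def, Real.fourierChar_apply, smul_eq_mul, mul_comm]
  congr 2
  simp only [RCLike.inner_apply, conj_trivial]
  push_cast
  have : (Real.pi : ℂ) ≠ 0 := by exact_mod_cast Real.pi_ne_zero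
  field_simp

theorem lintegral_enorm_sq_integral_mul_exp_neg {h : ℝ → ℂ} (h1 : Integrable h)
    (h2 : MemLp h 2 volume) :
    ∫⁻ t : ℝ, ‖∫ x : ℝ, h x * Complex.exp (Complex.I * x * ((-t : ℝ) : ℂ))‖ₑ ^ 2 =
      ENNReal.ofReal (2 * Real.pi) * ∫⁻ x, ‖h x‖ₑ ^ 2 := by
  simp_rw [integral_mul_exp_neg_eq_fourier]
  have hpi : (2 * Real.pi)⁻¹ ≠ 0 := inv_ne_zero Real.two_pi_pos.ne'
  have embedding : MeasurableEmbedding fun t : ℝ => t * (2 * Real.pi)⁻¹ :=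
    (Homeomorph.mulRight₀ _ hpi).measurableEmbedding
  rw [← embedding.lintegral_map (fun ξ => ‖𝓕 h ξ‖ₑ ^ 2), Real.map_volume_mul_right hpi,
     lintegral_smul_measure, inv_inv, abs_of_pos Real.two_pi_pos,
    lintegral_enorm_sq_fourier h1 h2, smul_eq_mul]

end Plancherel

section MatrixElements

variable {H : Type*} [NormedAddCommGroup H] [InnerProductSpace ℂ H]

theorem isClosed_setOf_lintegral_enorm_sq_inner_le {X : Type*} [MeasurableSpace X] {ν : Measure X}
    {v : X → H} (hv : AEStronglyMeasurable v ν) {D : ℝ≥0∞} (hD : D ≠ ∞) :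
    IsClosed {x : H | ∫⁻ t, ‖⟪x, v t⟫_ℂ‖ₑ ^ 2 ∂ν ≤ D * ‖x‖ₑ ^ 2} := by
  refine IsSeqClosed.isClosed fun x x₀ hx hx₀ => ?_
  have tendsto_bound : Tendsto (fun n => D * ‖x n‖ₑ ^ 2) atTop (𝓝 (D * ‖x₀‖ₑ ^ 2)) :=
    ENNReal.Tendsto.const_mul (((ENNReal.continuous_pow 2).tendsto _).comp hx₀.enorm) (.inr hD)
  have tendsto_integrand (t : X) :
      Tendsto (fun n => ‖⟪x n, v t⟫_ℂ‖ₑ ^ 2) atTop (𝓝 (‖⟪x₀, v t⟫_ℂ‖ₑ ^ 2)) :=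
    ((ENNReal.continuous_pow 2).tendsto _).comp (hx₀.inner tendsto_const_nhds).enorm
  calc ∫⁻ t, ‖⟪x₀, v t⟫_ℂ‖ₑ ^ 2 ∂ν
      = ∫⁻ t, liminf (fun n => ‖⟪x n, v t⟫_ℂ‖ₑ ^ 2) atTop ∂ν := by
        simp_rw [(tendsto_integrand _).liminf_eq]
    _ ≤ liminf (fun n => ∫⁻ t, ‖⟪x n, v t⟫_ℂ‖ₑ ^ 2 ∂ν) atTop :=
        lintegral_liminf_le' fun n => by fun_prop
    _ ≤ liminf (fun n => D * ‖x n‖ₑ ^ 2) atTop := liminf_le_liminf (Eventually.of_forall hx)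
    _ = D * ‖x₀‖ₑ ^ 2 := tendsto_bound.liminf_eq

namespace ProjectionValuedMeasure

variable [CompleteSpace H] (E : ProjectionValuedMeasure H) {φ : H}

theorem inner_integral_apply_group_apply {f : ℝ → ℂ} (hf : IsBddMeasurable f) (t : ℝ) (φ : H) :
    ⟪E.integral f φ, E.group t φ⟫_ℂ =
      ∫ x : ℝ, starRingEnd ℂ (f x) * Complex.exp (Complex.I * x * t) ∂(E.scalarMeasure φ) := by
  rw [← ContinuousLinearMap.adjoint_inner_right, ← ContinuousLinearMap.star_eq_adjoint,
    ← E.isFormCalculus_integral.map_conj hf, group, ← mul_apply_eq_comp,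
    ← E.isBorelCalculus_integral.map_mul hf.conj (isBddMeasurable_exp t),
    E.isFormCalculus_integral.hasForm (hf.conj.mul (isBddMeasurable_exp t))]

/-- The cyclic subspace `{f(B) φ}` of `φ`. -/
def cyclicSubspace (φ : H) : Submodule ℂ H where
  carrier := {ψ | ∃ f, IsBddMeasurable f ∧ E.integral f φ = ψ}
  zero_mem' := ⟨_, .const 0, by rw [E.isFormCalculus_integral.map_zero, zero_apply]⟩
  add_mem' := by
    rintro _ _ ⟨f, hf, rfl⟩ ⟨g, hg, rfl⟩
    exact ⟨_, hf.add hg, by rw [E.isFormCalculus_integral.map_add hf hg, add_apply]⟩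
  smul_mem' := by
    rintro a _ ⟨f, hf, rfl⟩
    exact ⟨_, (IsBddMeasurable.const a).mul hf, by
      rw [E.isFormCalculus_integral.map_const_mul a hf, smul_apply]⟩

/-- On the cyclic subspace the matrix element `t ↦ ⟪f(B) φ, e^{-iBt} φ⟫` is the Fourier transform of
the conjugate of `f` times the spectral density of `φ`, so that Plancherel's theorem applies. -/
theorem lintegral_enorm_sq_inner_group_le_of_mem_cyclicSubspace {w : ℝ → ℝ≥0} (hw : Measurable w)
    {c : ℝ≥0} (hc : ∀ x, w x ≤ c) (h : E.scalarMeasure φ = volume.withDensity fun x => w x) {ψ : H}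
    (hψ : ψ ∈ E.cyclicSubspace φ) :
    ∫⁻ t : ℝ, ‖⟪ψ, E.group (-t) φ⟫_ℂ‖ₑ ^ 2 ≤ ENNReal.ofReal (2 * Real.pi) * c * ‖ψ‖ₑ ^ 2 := by
  obtain ⟨f, hf, rfl⟩ := hψ
  let g (x : ℝ) : ℂ := w x * starRingEnd ℂ (f x)
  have enorm_g (x : ℝ) : ‖g x‖ₑ = w x * ‖f x‖ₑ := by
    rw [enorm_mul, ← ofReal_norm, Complex.norm_of_nonneg (w x).coe_nonneg,
      ENNReal.ofReal_coe_nnreal, RCLike.enorm_conj]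
  have g_integrable : Integrable g := by
    have := hf.conj.integrable (E.scalarMeasure φ)
    rw [h, integrable_withDensity_iff_integrable_smul hw] at this
    exact this
  have g_memLp : MemLp g 2 volume := by
    obtain ⟨b, hb⟩ := hf.bounded
    refine (memLp_two_iff_integrable_sq_norm g_integrable.1).2 ?_
    simp_rw [sq]
    refine g_integrable.norm.bdd_mul g_integrable.1.norm (c := c * b) (.of_forall fun x => ?_)
    rw [norm_norm, norm_mul, Complex.norm_of_nonneg (w x).coe_nonneg, RCLike.norm_conj]
    exact mul_le_mul (hc x) (hb x) (norm_nonneg _) c.coe_nonneg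
  have inner_eq (t : ℝ) : ⟪E.integral f φ, E.group (-t) φ⟫_ℂ =
      ∫ x : ℝ, g x * Complex.exp (Complex.I * x * ((-t : ℝ) : ℂ)) := by
    rw [E.inner_integral_apply_group_apply hf, h, integral_withDensity_eq_integral_smul hw]
    simp only [g, NNReal.smul_def, Complex.real_smul, mul_assoc]
  simp_rw [inner_eq, lintegral_enorm_sq_integral_mul_exp_neg g_integrable g_memLp,
    E.isBorelCalculus_integral.enorm_sq_map_apply hf, h, mul_assoc]
  rw [lintegral_withDensity_eq_lintegral_mul _ hw.coe_nnreal_ennreal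
    (hf.measurable.enorm.pow_const 2), ← lintegral_const_mul' _ _ ENNReal.coe_ne_top]
  refine mul_le_mul_right (lintegral_mono fun x => ?_) _
  rw [enorm_g, mul_pow, sq, mul_assoc]
  exact mul_le_mul_left (ENNReal.coe_le_coe.2 (hc x)) _

theorem exists_lintegral_enorm_sq_inner_group_le (hφ : φ ∈ E.boundedDensity) :
    ∃ D : ℝ≥0, ∀ x : H, ∫⁻ t : ℝ, ‖⟪x, E.group (-t) φ⟫_ℂ‖ₑ ^ 2 ≤ D * ‖x‖ₑ ^ 2 := by
  obtain ⟨w, hw, ⟨c, hc⟩, h⟩ := E.mem_boundedDensity_iff.1 hφ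
  refine ⟨Real.toNNReal (2 * Real.pi) * c, fun x => ?_⟩
  let P := (E.cyclicSubspace φ).topologicalClosure.starProjection
  have group_mem (t : ℝ) : E.group (-t) φ ∈ (E.cyclicSubspace φ).topologicalClosure :=
    Submodule.le_topologicalClosure _ ⟨_, isBddMeasurable_exp (-t), rfl⟩
  have inner_eq (t : ℝ) : ⟪x, E.group (-t) φ⟫_ℂ = ⟪P x, E.group (-t) φ⟫_ℂ := by
    rw [Submodule.inner_starProjection_left_eq_right,
      Submodule.starProjection_eq_self_iff.2 (group_mem t)]
  have closed := isClosed_setOf_lintegral_enorm_sq_inner_le (ν := volume)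
    ((E.continuous_group_apply φ).comp continuous_neg).aestronglyMeasurable
    (D := (Real.toNNReal (2 * Real.pi) * c : ℝ≥0)) ENNReal.coe_ne_top
  have bound : ∫⁻ t : ℝ, ‖⟪P x, E.group (-t) φ⟫_ℂ‖ₑ ^ 2
      ≤ (Real.toNNReal (2 * Real.pi) * c : ℝ≥0) * ‖P x‖ₑ ^ 2 :=
    closure_minimal (fun ψ hψ =>
      E.lintegral_enorm_sq_inner_group_le_of_mem_cyclicSubspace hw hc h hψ) closed
      (Submodule.topologicalClosure_coe (E.cyclicSubspace φ) ▸
        Submodule.starProjection_apply_mem _ x)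
  simp_rw [inner_eq]
  refine bound.trans ?_
  gcongr
  rw [← ofReal_norm, ← ofReal_norm]
  exact ENNReal.ofReal_le_ofReal (Submodule.norm_starProjection_apply_le _ x)

end ProjectionValuedMeasure

end MatrixElements

/-! ### Hilbert–Schmidt and trace class operators -/

section HilbertSchmidt

variable {H₀ H₁ H₂ : Type*} [NormedAddCommGroup H₀] [InnerProductSpace ℂ H₀]
  [NormedAddCommGroup H₁] [InnerProductSpace ℂ H₁] [NormedAddCommGroup H₂] [InnerProductSpace ℂ H₂]

/-- `T` is a Hilbert–Schmidt operator: `∑ ‖T e‖² < ∞`, where `e` runs through an orthonormal basis.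
(The value of the sum does not depend on the basis.) -/
def IsHilbertSchmidt (T : H₀ →L[ℂ] H₁) : Prop :=
  ∃ (s : Set H₀) (b : HilbertBasis s ℂ H₀), Summable fun i => ‖T (b i)‖ ^ 2

theorem exists_norm_le_one_eq_comp [CompleteSpace H₁] [CompleteSpace H₂]
    {T : H₀ →L[ℂ] H₂} {S : H₀ →L[ℂ] H₁} (h : ∀ v, ‖T v‖ ≤ ‖S v‖) :
    ∃ U : H₁ →L[ℂ] H₂, ‖U‖ ≤ 1 ∧ T = U ∘L S := by
  let W := (LinearMap.range (S : H₀ →ₗ[ℂ] H₁)).topologicalClosure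
  have apply_mem (v : H₀) : S v ∈ W := Submodule.le_topologicalClosure _ ⟨v, rfl⟩
  let e : H₀ →ₗ[ℂ] W := (S : H₀ →ₗ[ℂ] H₁).codRestrict W apply_mem
  have denseRange : DenseRange e := fun w => by
    rw [Topology.IsInducing.subtypeVal.closure_eq_preimage_closure_image, Set.mem_preimage,
      ← Set.range_comp]
    exact w.2
  have bound (v : H₀) : ‖(T : H₀ →ₗ[ℂ] H₂) v‖ ≤ 1 * ‖e v‖ := (h v).trans_eq (one_mul _).symm
  refine ⟨(T : H₀ →ₗ[ℂ] H₂).extendOfNorm e ∘L W.orthogonalProjectionOnto, ?_, ?_⟩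
  · refine (ContinuousLinearMap.opNorm_comp_le _ _).trans ?_
    exact mul_le_one₀ (LinearMap.opNorm_extendOfNorm_le denseRange zero_le_one bound)
      (norm_nonneg _) W.orthogonalProjectionOnto_norm_le
  · ext v
    have proj_apply : W.orthogonalProjectionOnto (S v) = e v :=
      Submodule.orthogonalProjectionOnto_mem_subspace_eq_self (e v)
    rw [ContinuousLinearMap.comp_apply, ContinuousLinearMap.comp_apply, proj_apply,
      LinearMap.extendOfNorm_eq denseRange ⟨1, bound⟩]
    rfl

theorem hasSum_norm_sq_inner {ι : Type*} (b : HilbertBasis ι ℂ H₀) (v : H₀) :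
    HasSum (fun i => ‖⟪b i, v⟫_ℂ‖ ^ 2) (‖v‖ ^ 2) := by
  have term_eq (i : ι) : ⟪v, b i⟫_ℂ * ⟪b i, v⟫_ℂ = ((‖⟪b i, v⟫_ℂ‖ ^ 2 : ℝ) : ℂ) := by
    rw [← inner_conj_symm, Complex.conj_mul', Complex.ofReal_pow]
  have h := b.hasSum_inner_mul_inner v v
  simp_rw [term_eq] at h
  rw [inner_self_eq_norm_sq_to_K] at h
  rw [← Complex.hasSum_ofReal]
  simpa using h

variable [CompleteSpace H₀] [CompleteSpace H₁]

theorem hasSum_norm_sq_inner_apply {ι : Type*} (b : HilbertBasis ι ℂ H₀) (T : H₀ →L[ℂ] H₁)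
    (v : H₁) : HasSum (fun i => ‖⟪T (b i), v⟫_ℂ‖ ^ 2) (‖T.adjoint v‖ ^ 2) := by
  simpa only [ContinuousLinearMap.adjoint_inner_right] using hasSum_norm_sq_inner b (T.adjoint v)

theorem enorm_sq_adjoint_apply {ι : Type*} (b : HilbertBasis ι ℂ H₀) (T : H₀ →L[ℂ] H₁) (v : H₁) :
    ‖T.adjoint v‖ₑ ^ 2 =
      ∑' i : Function.support fun i => ‖T (b i)‖ ^ 2, ‖⟪T (b i), v⟫_ℂ‖ₑ ^ 2 := by
  have h := hasSum_norm_sq_inner_apply b T v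
  simp_rw [← ofReal_norm, ← ENNReal.ofReal_pow (norm_nonneg _)]
  rw [← h.tsum_eq, ENNReal.ofReal_tsum_of_nonneg (fun i => by positivity) h.summable]
  refine (tsum_subtype_eq_of_support_subset (s := Function.support fun i => ‖T (b i)‖ ^ 2)
    (f := fun i => ENNReal.ofReal (‖⟪T (b i), v⟫_ℂ‖ ^ 2)) fun i hi hT => hi ?_).symm
  simp_all

theorem norm_cfcAbs_apply (T : H₀ →L[ℂ] H₀) (v : H₀) : ‖CFC.abs T v‖ = ‖T v‖ := by
  have sq_eq : ‖CFC.abs T v‖ ^ 2 = ‖T v‖ ^ 2 := by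
    rw [← inner_self_eq_norm_sq (𝕜 := ℂ), ← inner_self_eq_norm_sq (𝕜 := ℂ),
      ← ContinuousLinearMap.adjoint_inner_right, ← ContinuousLinearMap.adjoint_inner_right,
      ← ContinuousLinearMap.star_eq_adjoint, ← ContinuousLinearMap.star_eq_adjoint,
      (CFC.abs_nonneg T).isSelfAdjoint.star_eq, ← mul_apply_eq_comp, ← mul_apply_eq_comp,
      CFC.abs_mul_abs]
  exact (pow_left_inj₀ (norm_nonneg _) (norm_nonneg _) two_ne_zero).1 sq_eq

/-- With the polar decomposition `T = U |T|` the two factors are `U |T|^{1/2}` and `|T|^{1/2}`. -/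
theorem IsTraceClass.exists_eq_comp_adjoint {T : H₀ →L[ℂ] H₀} (hT : IsTraceClass T) :
    ∃ G S : H₀ →L[ℂ] H₀, IsHilbertSchmidt G ∧ IsHilbertSchmidt S ∧ T = G ∘L S.adjoint := by
  obtain ⟨s, b, hs⟩ := hT
  let S := CFC.sqrt (CFC.abs T)
  have sq_eq : S * S = CFC.abs T := CFC.sqrt_mul_sqrt_self _ (CFC.abs_nonneg T)
  have adjoint_eq : S.adjoint = S := (CFC.sqrt_nonneg (CFC.abs T)).isSelfAdjoint.adjoint_eq
  have summable : Summable fun i => ‖S (b i)‖ ^ 2 := hs.congr fun i => by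
    rw [← sq_eq, mul_apply_eq_comp, ← ContinuousLinearMap.adjoint_inner_left, adjoint_eq,
      inner_self_eq_norm_sq_to_K]
    norm_cast
  obtain ⟨U, norm_le, hU⟩ := exists_norm_le_one_eq_comp fun v => (norm_cfcAbs_apply T v).ge
  refine ⟨U ∘L S, S, ⟨s, b, ?_⟩, ⟨s, b, summable⟩, ?_⟩
  · refine summable.of_nonneg_of_le (fun i => by positivity) fun i => ?_
    gcongr
    exact (U.le_opNorm _).trans (mul_le_of_le_one_left (norm_nonneg _) norm_le)
  · rw [adjoint_eq, ContinuousLinearMap.comp_assoc]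
    exact hU.trans (congrArg (U ∘L ·) sq_eq.symm)

end HilbertSchmidt

section Smoothness

variable {H₀ H₁ H₂ : Type*} [NormedAddCommGroup H₀] [InnerProductSpace ℂ H₀] [CompleteSpace H₀]
  [NormedAddCommGroup H₁] [InnerProductSpace ℂ H₁] [CompleteSpace H₁]
  [NormedAddCommGroup H₂] [InnerProductSpace ℂ H₂] [CompleteSpace H₂]
  (E : ProjectionValuedMeasure H₂) {φ : H₂}

theorem memLp_two_and_integral_norm_sq_le {X F : Type*} [MeasurableSpace X] {μ : Measure X}
    [NormedAddCommGroup F] {f : X → F} (hf : AEStronglyMeasurable f μ) {D : ℝ≥0}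
    (h : ∫⁻ x, ‖f x‖ₑ ^ 2 ∂μ ≤ D) : MemLp f 2 μ ∧ ∫ x, ‖f x‖ ^ 2 ∂μ ≤ D := by
  simp_rw [← ofReal_norm, ← ENNReal.ofReal_pow (norm_nonneg _)] at h
  have nonneg : 0 ≤ᵐ[μ] fun x => ‖f x‖ ^ 2 := .of_forall fun x => by positivity
  refine ⟨(memLp_two_iff_integrable_sq_norm hf).2 ⟨hf.norm.pow 2, ?_⟩, ?_⟩
  · rw [hasFiniteIntegral_iff_ofReal nonneg]
    exact h.trans_lt ENNReal.coe_lt_top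
  · rw [integral_eq_lintegral_of_nonneg_ae nonneg (hf.norm.pow 2)]
    exact ENNReal.toReal_mono ENNReal.coe_ne_top h

theorem lintegral_enorm_sq_adjoint_group_le {D : ℝ≥0}
    (hD : ∀ x, ∫⁻ t : ℝ, ‖⟪x, E.group (-t) φ⟫_ℂ‖ₑ ^ 2 ≤ D * ‖x‖ₑ ^ 2) {ι : Type*}
    (b : HilbertBasis ι ℂ H₀) {T : H₀ →L[ℂ] H₁} (hT : Summable fun i => ‖T (b i)‖ ^ 2)
    (L : H₂ →L[ℂ] H₁) :
    ∫⁻ t : ℝ, ‖T.adjoint (L (E.group (-t) φ))‖ₑ ^ 2 ≤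
      D * (‖L‖ₑ ^ 2 * ∑' i, ‖T (b i)‖ₑ ^ 2) := by
  have : Countable (Function.support fun i => ‖T (b i)‖ ^ 2) := hT.countable_support.to_subtype
  have continuous_orbit : Continuous fun t : ℝ => E.group (-t) φ :=
    (E.continuous_group_apply φ).comp continuous_neg
  have enorm_adjoint_le (y : H₁) : ‖L.adjoint y‖ₑ ≤ ‖L‖ₑ * ‖y‖ₑ := by
    rw [← (ContinuousLinearMap.adjoint (𝕜 := ℂ)).enorm_map L]
    exact L.adjoint.le_opENorm y
  calc ∫⁻ t : ℝ, ‖T.adjoint (L (E.group (-t) φ))‖ₑ ^ 2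
      = ∑' i : Function.support fun i => ‖T (b i)‖ ^ 2,
          ∫⁻ t : ℝ, ‖⟪L.adjoint (T (b i)), E.group (-t) φ⟫_ℂ‖ₑ ^ 2 := by
        simp_rw [enorm_sq_adjoint_apply b, ← ContinuousLinearMap.adjoint_inner_left L]
        exact lintegral_tsum fun i =>
          (continuous_const.inner continuous_orbit).enorm.aemeasurable.pow_const 2
    _ ≤ ∑' i : Function.support fun i => ‖T (b i)‖ ^ 2, D * (‖L‖ₑ ^ 2 * ‖T (b i)‖ₑ ^ 2) := by
        refine ENNReal.tsum_le_tsum fun i => (hD _).trans ?_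
        rw [← mul_pow]
        gcongr
        exact enorm_adjoint_le _
    _ ≤ D * (‖L‖ₑ ^ 2 * ∑' i, ‖T (b i)‖ₑ ^ 2) := by
        rw [ENNReal.tsum_mul_left, ENNReal.tsum_mul_left]
        gcongr
        exact ENNReal.tsum_comp_le_tsum_of_injective Subtype.val_injective _

theorem IsHilbertSchmidt.exists_integral_norm_sq_adjoint_group_le {T : H₀ →L[ℂ] H₁}
    (hT : IsHilbertSchmidt T) (hφ : φ ∈ E.boundedDensity) :
    ∃ M : ℝ≥0, ∀ L : H₂ →L[ℂ] H₁,
      MemLp (fun t : ℝ => T.adjoint (L (E.group (-t) φ))) 2 volume ∧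
        ∫ t : ℝ, ‖T.adjoint (L (E.group (-t) φ))‖ ^ 2 ≤ M * ‖L‖ ^ 2 := by
  obtain ⟨s, b, hb⟩ := hT
  obtain ⟨D, hD⟩ := E.exists_lintegral_enorm_sq_inner_group_le hφ
  have continuous_orbit : Continuous fun t : ℝ => E.group (-t) φ :=
    (E.continuous_group_apply φ).comp continuous_neg
  refine ⟨D * ∑' i, ‖T (b i)‖₊ ^ 2, fun L => ?_⟩
  have summable : Summable fun i => ‖T (b i)‖₊ ^ 2 := NNReal.summable_coe.1 (by simpa using hb)
  refine memLp_two_and_integral_norm_sq_le (D := D * (∑' i, ‖T (b i)‖₊ ^ 2) * ‖L‖₊ ^ 2)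
    (T.adjoint.continuous.comp (L.continuous.comp continuous_orbit)).aestronglyMeasurable
    ((lintegral_enorm_sq_adjoint_group_le E hD b hb L).trans_eq ?_)
  push_cast [ENNReal.coe_tsum summable]
  simp only [enorm_eq_nnnorm]
  ring

/-- The series for `‖T† e^{-iBt} φ‖²` tends to zero term by term and is dominated by
`∑ ‖T e‖² ‖φ‖²`. -/
theorem IsHilbertSchmidt.tendsto_adjoint_group {T : H₀ →L[ℂ] H₂} (hT : IsHilbertSchmidt T)
    (hφ : φ ∈ E.acSubspace) :
    Tendsto (fun t : ℝ => T.adjoint (E.group (-t) φ)) atTop (𝓝 0) := by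
  obtain ⟨s, b, hb⟩ := hT
  have tendsto_sq : Tendsto (fun t : ℝ => ‖T.adjoint (E.group (-t) φ)‖ ^ 2) atTop (𝓝 0) := by
    simp_rw [← (hasSum_norm_sq_inner_apply b T _).tsum_eq]
    rw [← tsum_zero (β := s)]
    refine tendsto_tsum_of_dominated_convergence (bound := fun i => ‖T (b i)‖ ^ 2 * ‖φ‖ ^ 2)
      (hb.mul_right _) (fun i => ?_) (.of_forall fun t i => ?_)
    · simpa using (E.tendsto_inner_group (T (b i)) hφ).norm.pow 2
    · rw [norm_pow, norm_norm, ← mul_pow]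
      gcongr
      exact (norm_inner_le_norm _ _).trans_eq (by rw [E.norm_group_apply])
  rw [tendsto_zero_iff_norm_tendsto_zero]
  simpa using tendsto_sq.sqrt

end Smoothness

/-! ### Convergence of curves by Pearson's method -/

section Curves

theorem tendsto_sub_of_tendsto_deriv_zero {F : Type*} [NormedAddCommGroup F] [NormedSpace ℝ F]
    {y y' : ℝ → F} (hy : ∀ r, HasDerivAt y (y' r) r) (h0 : Tendsto y' atTop (𝓝 0)) (t s : ℝ) :
    Tendsto (fun a => y (t + a) - y (s + a)) atTop (𝓝 0) := by
  rw [NormedAddGroup.tendsto_nhds_zero] at h0 ⊢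
  intro ε hε
  obtain ⟨r, hr⟩ := eventually_atTop.1 (h0 (ε / (|t - s| + 1)) (by positivity))
  filter_upwards [eventually_ge_atTop (r - t), eventually_ge_atTop (r - s)] with a hat has
  have mean_value : ‖y (t + a) - y (s + a)‖ ≤ ε / (|t - s| + 1) * ‖t + a - (s + a)‖ :=
    (convex_Ici r).norm_image_sub_le_of_norm_hasDerivWithin_le
      (fun x _ => (hy x).hasDerivWithinAt) (fun x hx => (hr x hx).le)
      (Set.mem_Ici.2 (by linarith)) (Set.mem_Ici.2 (by linarith))
  refine mean_value.trans_lt ?_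
  rw [add_sub_add_right_eq_sub, Real.norm_eq_abs, div_mul_eq_mul_div, div_lt_iff₀ (by positivity)]
  linarith

/-- The estimate comes from integrating the derivative of `‖y (t + a) - y (s + a)‖²` over `a > 0`;
the boundary term at infinity vanishes. -/
theorem norm_sub_sq_le_integral_of_norm_inner_deriv_le {F : Type*} [NormedAddCommGroup F]
    [InnerProductSpace ℂ F] {y y' : ℝ → F} (hy : ∀ r, HasDerivAt y (y' r) r)
    (h0 : Tendsto y' atTop (𝓝 0)) (t s : ℝ) {f : ℝ → ℝ} (hf : IntegrableOn f (Set.Ioi 0))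
    (hle : ∀ a, ‖⟪y (t + a) - y (s + a), y' (t + a) - y' (s + a)⟫_ℂ‖ ≤ f a) :
    ‖y t - y s‖ ^ 2 ≤ 2 * ∫ a in Set.Ioi 0, f a := by
  let δ (a : ℝ) : F := y (t + a) - y (s + a)
  let δ' (a : ℝ) : F := y' (t + a) - y' (s + a)
  have hasDerivAt_sub (a : ℝ) : HasDerivAt δ (δ' a) a :=
    ((hy (t + a)).comp_const_add t a).sub ((hy (s + a)).comp_const_add s a)
  have hasDerivAt_inner (a : ℝ) :
      HasDerivAt (fun a => ⟪δ a, δ a⟫_ℂ) (⟪δ a, δ' a⟫_ℂ + ⟪δ' a, δ a⟫_ℂ) a :=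
    (hasDerivAt_sub a).inner ℂ (hasDerivAt_sub a)
  have deriv_le (a : ℝ) : ‖⟪δ a, δ' a⟫_ℂ + ⟪δ' a, δ a⟫_ℂ‖ ≤ 2 * f a := by
    have norm_symm : ‖⟪δ' a, δ a⟫_ℂ‖ = ‖⟪δ a, δ' a⟫_ℂ‖ := norm_inner_symm _ _
    linarith [norm_add_le ⟪δ a, δ' a⟫_ℂ ⟪δ' a, δ a⟫_ℂ, show ‖⟪δ a, δ' a⟫_ℂ‖ ≤ f a from hle a]
  have measurable_deriv : AEStronglyMeasurable (fun a => ⟪δ a, δ' a⟫_ℂ + ⟪δ' a, δ a⟫_ℂ)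
      (volume.restrict (Set.Ioi 0)) := by
    rw [← funext fun a => (hasDerivAt_inner a).deriv]
    exact (stronglyMeasurable_deriv _).aestronglyMeasurable
  have tendsto_zero : Tendsto (fun a => ⟪δ a, δ a⟫_ℂ) atTop (𝓝 0) := by
    have h := tendsto_sub_of_tendsto_deriv_zero hy h0 t s
    simpa using h.inner (𝕜 := ℂ) h
  have integral_eq := integral_Ioi_of_hasDerivAt_of_tendsto'
    (fun a (_ : a ∈ Set.Ici 0) => hasDerivAt_inner a)
    ((hf.const_mul 2).mono' measurable_deriv (.of_forall deriv_le)) tendsto_zero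
  calc ‖y t - y s‖ ^ 2 = ‖⟪δ 0, δ 0⟫_ℂ‖ := by
        simp only [δ, add_zero, inner_self_eq_norm_sq_to_K, norm_pow]
        simp
    _ = ‖∫ a in Set.Ioi 0, (⟪δ a, δ' a⟫_ℂ + ⟪δ' a, δ a⟫_ℂ)‖ := by
        rw [integral_eq, zero_sub, norm_neg]
    _ ≤ ∫ a in Set.Ioi 0, 2 * f a :=
        norm_integral_le_of_norm_le (hf.const_mul 2) (.of_forall deriv_le)
    _ = 2 * ∫ a in Set.Ioi 0, f a := integral_const_mul _ _

theorem integral_mul_le_sqrt_mul_sqrt {X : Type*} [MeasurableSpace X] {μ : Measure X} {f g : X → ℝ}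
    (hf : MemLp f 2 μ) (hg : MemLp g 2 μ) (hf0 : 0 ≤ f) (hg0 : 0 ≤ g) :
    ∫ x, f x * g x ∂μ ≤ √(∫ x, f x ^ 2 ∂μ) * √(∫ x, g x ^ 2 ∂μ) := by
  have h := integral_mul_le_Lp_mul_Lq_of_nonneg Real.HolderConjugate.two_two
    (.of_forall hf0) (.of_forall hg0) (by simpa using hf) (by simpa using hg)
  simpa only [Real.rpow_two, ← Real.sqrt_eq_rpow] using h

theorem preimage_add_left_Ioi_self (q : ℝ) : (q + ·) ⁻¹' Set.Ioi q = Set.Ioi 0 := by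
  rw [Set.preimage_const_add_Ioi, sub_self]

theorem integral_Ioi_zero_comp_add_left (f : ℝ → ℝ) (q : ℝ) :
    ∫ x in Set.Ioi 0, f (q + x) = ∫ x in Set.Ioi q, f x := by
  rw [← preimage_add_left_Ioi_self q]
  exact (measurePreserving_add_left volume q).setIntegral_preimage_emb
    (measurableEmbedding_addLeft q) f _

theorem integrableOn_Ioi_zero_comp_add_left {f : ℝ → ℝ} (hf : IntegrableOn f (Set.Ioi 0)) {q : ℝ}
    (hq : 0 ≤ q) : IntegrableOn (fun x => f (q + x)) (Set.Ioi 0) := by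
  rw [← preimage_add_left_Ioi_self q]
  exact ((measurePreserving_add_left volume q).integrableOn_comp_preimage
    (measurableEmbedding_addLeft q)).2 (hf.mono_set (Set.Ioi_subset_Ioi hq))

theorem memLp_two_comp_add_left {f : ℝ → ℝ} (hf : MemLp f 2 volume) (q : ℝ) (s : Set ℝ) :
    MemLp (fun x => f (q + x)) 2 (volume.restrict s) :=
  (hf.comp_measurePreserving (measurePreserving_add_left volume q)).restrict s

theorem integrableOn_and_integral_Ioi_mul_add_le {a b γ : ℝ → ℝ} (ha : MemLp a 2 volume)
    (hb : MemLp b 2 volume) (ha0 : 0 ≤ a) (hb0 : 0 ≤ b) {κ : ℝ} (hκ : ∫ x, b x ^ 2 ≤ κ)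
    (hγ : IntegrableOn γ (Set.Ioi 0)) (r : ℝ) {q : ℝ} (hq : 0 ≤ q) :
    IntegrableOn (fun x => b (r + x) * a (q + x) + γ (q + x)) (Set.Ioi 0) ∧
      ∫ x in Set.Ioi 0, (b (r + x) * a (q + x) + γ (q + x)) ≤
        √κ * √(∫ x in Set.Ioi q, a x ^ 2) + ∫ x in Set.Ioi q, γ x := by
  have memLp_a := memLp_two_comp_add_left ha q (Set.Ioi 0)
  have memLp_b := memLp_two_comp_add_left hb r (Set.Ioi 0)
  have integrable_mul : IntegrableOn (fun x => b (r + x) * a (q + x)) (Set.Ioi 0) :=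
    memLp_b.integrable_mul memLp_a
  have integrable_γ := integrableOn_Ioi_zero_comp_add_left hγ hq
  refine ⟨integrable_mul.add integrable_γ, ?_⟩
  rw [integral_add integrable_mul integrable_γ, integral_Ioi_zero_comp_add_left γ]
  refine add_le_add_left ((integral_mul_le_sqrt_mul_sqrt memLp_b memLp_a (fun x => hb0 (r + x))
    fun x => ha0 (q + x)).trans ?_) _
  rw [integral_Ioi_zero_comp_add_left fun x => b x ^ 2,
    integral_Ioi_zero_comp_add_left fun x => a x ^ 2]
  gcongr
  exact (setIntegral_le_integral hb.integrable_sq (.of_forall fun x => sq_nonneg _)).trans hκ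

theorem exists_tendsto_of_norm_sub_sq_le {F : Type*} [NormedAddCommGroup F] [CompleteSpace F]
    {y : ℝ → F} {f : ℝ → ℝ} (hf : Tendsto f atTop (𝓝 0))
    (h : ∀ t s, 0 ≤ t → 0 ≤ s → ‖y t - y s‖ ^ 2 ≤ f t + f s) : ∃ l, Tendsto y atTop (𝓝 l) := by
  refine cauchySeq_tendsto_of_complete (Metric.cauchySeq_iff'.2 fun ε hε => ?_)
  obtain ⟨N, hN⟩ := eventually_atTop.1
    ((hf.eventually_lt_const (half_pos (sq_pos_of_pos hε))).and (eventually_ge_atTop 0))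
  refine ⟨N, fun t ht => lt_of_pow_lt_pow_left₀ 2 hε.le ?_⟩
  rw [dist_eq_norm]
  linarith [h t N (hN t ht).2 (hN N le_rfl).2, (hN t ht).1, (hN N le_rfl).1]

theorem exists_tendsto_of_norm_inner_deriv_le {F : Type*} [NormedAddCommGroup F]
    [InnerProductSpace ℂ F] [CompleteSpace F] {y y' : ℝ → F} (hy : ∀ r, HasDerivAt y (y' r) r)
    (h0 : Tendsto y' atTop (𝓝 0)) {a γ : ℝ → ℝ} {b : ℝ → ℝ → ℝ} {κ : ℝ} (ha : MemLp a 2 volume)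
    (hb : ∀ τ, MemLp (b τ) 2 volume) (ha0 : 0 ≤ a) (hb0 : ∀ τ, 0 ≤ b τ)
    (hκ : ∀ τ, ∫ x, b τ x ^ 2 ≤ κ) (hγ : IntegrableOn γ (Set.Ioi 0))
    (hle : ∀ r q, ‖⟪y r, y' q⟫_ℂ‖ ≤ b (r - q) r * a q + γ q) :
    ∃ l, Tendsto y atTop (𝓝 l) := by
  let g (r q x : ℝ) : ℝ := b (r - q) (r + x) * a (q + x) + γ (q + x)
  let f (q : ℝ) : ℝ := √κ * √(∫ x in Set.Ioi q, a x ^ 2) + ∫ x in Set.Ioi q, γ x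
  have tendsto_f : Tendsto f atTop (𝓝 0) := by
    have h1 := (tendsto_integral_Ioi_zero (f := fun x => a x ^ 2) (μ := volume) tendsto_id).sqrt
    have h2 := tendsto_integral_Ioi_zero (f := γ) (μ := volume) tendsto_id
    simpa using (h1.const_mul √κ).add h2
  have g_spec (r : ℝ) {q : ℝ} (hq : 0 ≤ q) :
      IntegrableOn (g r q) (Set.Ioi 0) ∧ ∫ x in Set.Ioi 0, g r q x ≤ f q :=
    integrableOn_and_integral_Ioi_mul_add_le ha (hb _) ha0 (hb0 _) (hκ _) hγ r hq
  have inner_le (r q x : ℝ) : ‖⟪y (r + x), y' (q + x)⟫_ℂ‖ ≤ g r q x := by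
    simpa only [add_sub_add_right_eq_sub] using hle (r + x) (q + x)
  refine exists_tendsto_of_norm_sub_sq_le (f := fun q => 4 * f q)
    (by simpa using tendsto_f.const_mul 4) fun t s ht hs => ?_
  have integrable_t := (g_spec t ht).1.add (g_spec s ht).1
  have integrable_s := (g_spec t hs).1.add (g_spec s hs).1
  refine (norm_sub_sq_le_integral_of_norm_inner_deriv_le hy h0 t s
    (integrable_t.add integrable_s) fun x => ?_).trans ?_
  · rw [inner_sub_right, inner_sub_left, inner_sub_left]
    refine (norm_sub_le _ _).trans (add_le_add ?_ ?_) <;>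
      exact (norm_sub_le _ _).trans (add_le_add (inner_le _ _ _) (inner_le _ _ _))
  · rw [integral_add' integrable_t integrable_s, integral_add' (g_spec t ht).1 (g_spec s ht).1,
      integral_add' (g_spec t hs).1 (g_spec s hs).1]
    linarith [(g_spec t ht).2, (g_spec s ht).2, (g_spec t hs).2, (g_spec s hs).2]

end Curves

/-! ### Wave operators -/

section Unitary

variable {H : Type*} [NormedAddCommGroup H] [InnerProductSpace ℂ H] [CompleteSpace H]

theorem ProjectionValuedMeasure.tendsto_group_apply (E : ProjectionValuedMeasure H) {ι : Type*}
    {l : Filter ι} {r : ι → ℝ} {t : ℝ} {v : ι → H} {v₀ : H} (hr : Tendsto r l (𝓝 t))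
    (hv : Tendsto v l (𝓝 v₀)) : Tendsto (fun i => E.group (r i) (v i)) l (𝓝 (E.group t v₀)) := by
  have moving : Tendsto (fun i => E.group (r i) (v i - v₀)) l (𝓝 0) := by
    rw [tendsto_zero_iff_norm_tendsto_zero]
    simp_rw [E.norm_group_apply]
    exact tendsto_iff_norm_sub_tendsto_zero.1 hv
  simpa using moving.add (((E.continuous_group_apply v₀).tendsto t).comp hr)

variable {B : H →ₗ.[ℂ] H} {E : ProjectionValuedMeasure H}

theorem HasSpectralTruncations.hasDerivAt_group_comp (hE : HasSpectralTruncations B E) {g : ℝ → H}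
    {g' : H} {t : ℝ} (hg : HasDerivAt g g' t) (ht : g t ∈ B.domain) :
    HasDerivAt (fun r => E.group r (g r))
      (Complex.I • E.group t (B ⟨g t, ht⟩) + E.group t g') t := by
  have moving : HasDerivAt (fun r => E.group r (g r - g t)) (E.group t g') t := by
    rw [hasDerivAt_iff_tendsto_slope] at hg ⊢
    refine (E.tendsto_group_apply (tendsto_id.mono_left nhdsWithin_le_nhds) hg).congr fun r => ?_
    simp only [slope_def_module, id_eq, sub_self, map_zero, sub_zero]
    rw [← Complex.coe_smul, map_smul, Complex.coe_smul]
  simpa using (hE.hasDerivAt_group_apply ⟨g t, ht⟩ t).fun_add moving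

theorem IsSpectralMeasure.resolvent_group_apply (hE : IsSpectralMeasure B E)
    (hd : Dense (B.domain : Set H)) {z : ℂ} {R : H →L[ℂ] H} (hR : IsResolventAt B z R) (t : ℝ)
    (φ : H) : R (E.group t φ) = E.group t (R φ) :=
  congrArg (· φ) (hE.commute_resolvent hd (isBddMeasurable_exp t) hR).eq

end Unitary

section WaveApprox

variable {H₀ H₁ H₂ : Type*} [NormedAddCommGroup H₀] [InnerProductSpace ℂ H₀]
  [NormedAddCommGroup H₁] [InnerProductSpace ℂ H₁] [NormedAddCommGroup H₂] [InnerProductSpace ℂ H₂]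

theorem norm_group_comp_le [CompleteSpace H₁] (EA : ProjectionValuedMeasure H₁) (J : H₂ →L[ℂ] H₁)
    (t : ℝ) : ‖EA.group t ∘L J‖ ≤ ‖J‖ :=
  ContinuousLinearMap.opNorm_le_bound _ (norm_nonneg _) fun v => by
    rw [ContinuousLinearMap.comp_apply, EA.norm_group_apply]
    exact J.le_opNorm v

theorem norm_apply_group_le [CompleteSpace H₂] (EB : ProjectionValuedMeasure H₂) (J : H₂ →L[ℂ] H₁)
    (t : ℝ) (φ : H₂) : ‖J (EB.group t φ)‖ ≤ ‖J‖ * ‖φ‖ :=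
  (J.le_opNorm _).trans_eq (by rw [EB.norm_group_apply])

variable [CompleteSpace H₀] [CompleteSpace H₂] {EB : ProjectionValuedMeasure H₂}

theorem tendsto_perturbation_group {G : H₀ →L[ℂ] H₁} {T : H₀ →L[ℂ] H₂} {C₂ : H₂ →L[ℂ] H₁} {φ : H₂}
    (hT : IsHilbertSchmidt T) (hφ : φ ∈ EB.acSubspace)
    (hlim : Tendsto (fun t : ℝ => C₂ (EB.group (-t) φ)) atTop (𝓝 0)) :
    Tendsto (fun t : ℝ => (G ∘L T.adjoint + C₂) (EB.group (-t) φ)) atTop (𝓝 0) := by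
  have h := (G.continuous.tendsto 0).comp (hT.tendsto_adjoint_group EB hφ)
  rw [map_zero] at h
  simpa using h.add hlim

variable [CompleteSpace H₁] {A : H₁ →ₗ.[ℂ] H₁} {B : H₂ →ₗ.[ℂ] H₂}
  {EA : ProjectionValuedMeasure H₁}

/-- The operator `e^{iAt} J e^{-iBt}`, where `A` and `B` are given by their spectral measures `EA`
and `EB`. Its strong limits as `t → ∞` are the wave operators. -/
def waveApprox (EA : ProjectionValuedMeasure H₁) (EB : ProjectionValuedMeasure H₂)
    (J : H₂ →L[ℂ] H₁) (t : ℝ) : H₂ →L[ℂ] H₁ :=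
  EA.group t ∘L J ∘L EB.group (-t)

theorem waveApprox_apply (J : H₂ →L[ℂ] H₁) (t : ℝ) (φ : H₂) :
    waveApprox EA EB J t φ = EA.group t (J (EB.group (-t) φ)) := rfl

theorem norm_waveApprox_apply (J : H₂ →L[ℂ] H₁) (t : ℝ) (φ : H₂) :
    ‖waveApprox EA EB J t φ‖ = ‖J (EB.group (-t) φ)‖ := EA.norm_group_apply t _

theorem hasDerivAt_waveApprox_resolvent_apply (hEA : IsSpectralMeasure A EA)
    (hEB : IsSpectralMeasure B EB) (hdA : Dense (A.domain : Set H₁))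
    (hdB : Dense (B.domain : Set H₂)) {z : ℂ} {RA : H₁ →L[ℂ] H₁} {RB : H₂ →L[ℂ] H₂}
    (hRA : IsResolventAt A z RA) (hRB : IsResolventAt B z RB) (K : H₂ →L[ℂ] H₁) (φ : H₂) (t : ℝ) :
    HasDerivAt (fun t => waveApprox EA EB (RA ∘L K ∘L RB) t φ)
      (Complex.I • waveApprox EA EB (K ∘L RB - RA ∘L K) t φ) t := by
  have hasDerivAt_resolvent : HasDerivAt (fun t => RB (EB.group (-t) φ))
      (-(Complex.I • EB.group (-t) (φ + z • RB φ))) t := by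
    have h := ((hEB.hasSpectralTruncations hdB).hasDerivAt_group_apply ⟨RB φ, hRB.mem_domain φ⟩
      (-t)).scomp t (hasDerivAt_neg t)
    rw [hRB.apply_map φ, neg_one_smul] at h
    simp_rw [hEB.resolvent_group_apply hdB hRB]
    exact h
  have hasDerivAt_inner := ((RA ∘L K).restrictScalars ℝ).hasFDerivAt.comp_hasDerivAt t
    hasDerivAt_resolvent
  refine ((hEA.hasSpectralTruncations hdA).hasDerivAt_group_comp
    (g := fun t => RA (K (RB (EB.group (-t) φ)))) hasDerivAt_inner
    (hRA.mem_domain _)).congr_deriv ?_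
  rw [hRA.apply_map]
  simp only [waveApprox_apply, ContinuousLinearMap.coe_restrictScalars',
    ContinuousLinearMap.comp_apply, sub_apply, map_add, map_sub, map_neg, map_smul,
    hEB.resolvent_group_apply hdB hRB]
  module

theorem norm_inner_waveApprox_le (G : H₀ →L[ℂ] H₁) (T : H₀ →L[ℂ] H₂) (J C₂ : H₂ →L[ℂ] H₁)
    (φ : H₂) (r q : ℝ) :
    ‖⟪waveApprox EA EB J r φ, waveApprox EA EB (G ∘L T.adjoint + C₂) q φ⟫_ℂ‖ ≤
      ‖G.adjoint ((EA.group (r - q) ∘L J) (EB.group (-r) φ))‖ * ‖T.adjoint (EB.group (-q) φ)‖ +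
        ‖J‖ * ‖φ‖ * ‖C₂ (EB.group (-q) φ)‖ := by
  have inner_eq : ⟪waveApprox EA EB J r φ, EA.group q (G (T.adjoint (EB.group (-q) φ)))⟫_ℂ =
      ⟪G.adjoint ((EA.group (r - q) ∘L J) (EB.group (-r) φ)), T.adjoint (EB.group (-q) φ)⟫_ℂ := by
    rw [ContinuousLinearMap.adjoint_inner_left, ContinuousLinearMap.comp_apply, sub_eq_neg_add,
      EA.group_add_apply, EA.inner_group_left, neg_neg, waveApprox_apply]
  rw [waveApprox_apply (G ∘L T.adjoint + C₂), add_apply, ContinuousLinearMap.comp_apply, map_add,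
    inner_add_right, inner_eq]
  refine (norm_add_le _ _).trans (add_le_add (norm_inner_le_norm _ _) ?_)
  refine (norm_inner_le_norm _ _).trans ?_
  rw [EA.norm_group_apply, norm_waveApprox_apply]
  gcongr
  exact norm_apply_group_le EB J _ _

theorem exists_tendsto_waveApprox_of_hasDerivAt {G : H₀ →L[ℂ] H₁} {T : H₀ →L[ℂ] H₂}
    {J C₂ : H₂ →L[ℂ] H₁} {φ : H₂} (hG : IsHilbertSchmidt G) (hT : IsHilbertSchmidt T)
    (hder : ∀ t, HasDerivAt (fun t => waveApprox EA EB J t φ)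
      (Complex.I • waveApprox EA EB (G ∘L T.adjoint + C₂) t φ) t)
    (hφ : φ ∈ EB.boundedDensity)
    (hlim : Tendsto (fun t : ℝ => C₂ (EB.group (-t) φ)) atTop (𝓝 0))
    (hint : IntegrableOn (fun t : ℝ => ‖C₂ (EB.group (-t) φ)‖) (Set.Ioi 0)) :
    ∃ l, Tendsto (fun t => waveApprox EA EB J t φ) atTop (𝓝 l) := by
  obtain ⟨M, hM⟩ := hG.exists_integral_norm_sq_adjoint_group_le EB hφ
  obtain ⟨N, hN⟩ := hT.exists_integral_norm_sq_adjoint_group_le EB hφ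
  have tendsto_deriv : Tendsto (fun t =>
      Complex.I • waveApprox EA EB (G ∘L T.adjoint + C₂) t φ) atTop (𝓝 0) := by
    have h := tendsto_perturbation_group (G := G) hT (EB.boundedDensity_subset_acSubspace hφ) hlim
    rw [tendsto_zero_iff_norm_tendsto_zero] at h ⊢
    simpa only [norm_smul, Complex.norm_I, one_mul, norm_waveApprox_apply] using h
  refine exists_tendsto_of_norm_inner_deriv_le hder tendsto_deriv
    (a := fun q => ‖T.adjoint (EB.group (-q) φ)‖) (κ := M * ‖J‖ ^ 2)
    (b := fun τ r => ‖G.adjoint ((EA.group τ ∘L J) (EB.group (-r) φ))‖)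
    (γ := fun q => ‖J‖ * ‖φ‖ * ‖C₂ (EB.group (-q) φ)‖)
    (hN (.id ℂ H₂)).1.norm (fun τ => (hM _).1.norm) (fun q => norm_nonneg _)
    (fun τ r => norm_nonneg _) (fun τ => (hM _).2.trans ?_) (hint.const_mul _) fun r q => ?_
  · gcongr
    exact norm_group_comp_le EA J τ
  · rw [inner_smul_right, norm_mul, Complex.norm_I, one_mul]
    exact norm_inner_waveApprox_le G T J C₂ φ r q

end WaveApprox

section StrongLimit

variable {𝕜 H₁ H₂ : Type*} [NontriviallyNormedField 𝕜] [NormedAddCommGroup H₁] [NormedSpace 𝕜 H₁]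
  [NormedAddCommGroup H₂] [NormedSpace 𝕜 H₂] {ι : Type*} {l : Filter ι} {W : ι → H₂ →L[𝕜] H₁}
  {c : ℝ} {S : Set H₂} {φ : H₂}

theorem tendsto_zero_of_mem_closure (hW : ∀ i v, ‖W i v‖ ≤ c * ‖v‖)
    (hS : ∀ φ ∈ S, Tendsto (fun i => W i φ) l (𝓝 0)) (hφ : φ ∈ closure S) :
    Tendsto (fun i => W i φ) l (𝓝 0) := by
  have equicontinuous : Equicontinuous fun i => ⇑(W i) :=
    (LipschitzWith.uniformEquicontinuous _ c.toNNReal fun i =>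
      AddMonoidHomClass.lipschitz_of_bound (W i) c (hW i)).equicontinuous
  exact closure_minimal hS (equicontinuous.isClosed_setOfPred_tendsto continuous_const) hφ

theorem exists_tendsto_of_mem_closure [CompleteSpace H₁] [l.NeBot]
    (hW : ∀ i v, ‖W i v‖ ≤ c * ‖v‖) (hS : ∀ φ ∈ S, ∃ x, Tendsto (fun i => W i φ) l (𝓝 x))
    (hφ : φ ∈ closure S) : ∃ x, Tendsto (fun i => W i φ) l (𝓝 x) := by
  simp_rw [← cauchy_map_iff_exists_tendsto, IsUniformAddGroup.cauchy_map_iff_tendsto] at hS ⊢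
  have norm_sub_le (p : ι × ι) (v : H₂) : ‖(W p.1 - W p.2) v‖ ≤ (c + c) * ‖v‖ := by
    rw [add_mul]
    exact norm_sub_le_of_le (hW _ v) (hW _ v)
  exact ⟨‹_›, tendsto_zero_of_mem_closure norm_sub_le (fun φ hφ => (hS φ hφ).2) hφ⟩

end StrongLimit

section WaveOperator

variable {H : Type*} [NormedAddCommGroup H] [InnerProductSpace ℂ H]

theorem isResolventAt_resolvent {A : H →ₗ.[ℂ] H} {z : ℂ} (hz : z ∈ resolventSet A) :
    IsResolventAt A z (resolvent A z) := by
  have hz' : ∃ R : H →L[ℂ] H, IsResolventAt A z R := hz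
  rw [resolvent, dif_pos hz']
  exact hz'.choose_spec

theorem IsSpectralMeasure.acSubspace_subset_closure_image_resolvent_resolvent [CompleteSpace H]
    {B : H →ₗ.[ℂ] H} {E : ProjectionValuedMeasure H} (hE : IsSpectralMeasure B E)
    (hd : Dense (B.domain : Set H)) {z : ℂ} {R : H →L[ℂ] H} (hR : IsResolventAt B z R) :
    (E.acSubspace : Set H) ⊆ closure ((fun φ => R (R φ)) '' E.acSubspace) := by
  have h := hE.acSubspace_subset_closure_image_resolvent hd hR
  refine h.trans (closure_minimal ?_ isClosed_closure)
  rw [← Function.comp_def, Set.image_comp]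
  exact (Set.image_mono h).trans (image_closure_subset_closure_image R.continuous)

variable {H₀ H₁ H₂ : Type*} [NormedAddCommGroup H₀] [InnerProductSpace ℂ H₀] [CompleteSpace H₀]
  [NormedAddCommGroup H₁] [InnerProductSpace ℂ H₁] [CompleteSpace H₁] [NormedAddCommGroup H₂]
  [InnerProductSpace ℂ H₂] [CompleteSpace H₂] {A : H₁ →ₗ.[ℂ] H₁} {B : H₂ →ₗ.[ℂ] H₂}
  {EA : ProjectionValuedMeasure H₁} {EB : ProjectionValuedMeasure H₂}

theorem norm_waveApprox_apply_le (J : H₂ →L[ℂ] H₁) (t : ℝ) (φ : H₂) :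
    ‖waveApprox EA EB J t φ‖ ≤ ‖J‖ * ‖φ‖ :=
  (norm_waveApprox_apply J t φ).trans_le (norm_apply_group_le EB J _ φ)

theorem exists_tendsto_waveApprox_of_resolvent (hEB : IsSpectralMeasure B EB)
    (hdB : Dense (B.domain : Set H₂)) {z : ℂ} {RB : H₂ →L[ℂ] H₂} (hRB : IsResolventAt B z RB)
    {K : H₂ →L[ℂ] H₁} {L : H₁ →L[ℂ] H₁}
    (hL : ∀ φ ∈ EB.acSubspace,
      ∃ l, Tendsto (fun t => waveApprox EA EB (L ∘L K ∘L RB) t φ) atTop (𝓝 l))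
    (hC : ∀ φ ∈ EB.acSubspace,
      Tendsto (fun t : ℝ => (K ∘L RB - L ∘L K) (EB.group (-t) φ)) atTop (𝓝 0))
    {φ : H₂} (hφ : φ ∈ EB.acSubspace) :
    ∃ l, Tendsto (fun t => waveApprox EA EB K t φ) atTop (𝓝 l) := by
  refine exists_tendsto_of_mem_closure (norm_waveApprox_apply_le K) ?_
    (hEB.acSubspace_subset_closure_image_resolvent_resolvent hdB hRB hφ)
  rintro _ ⟨ψ, hψ, rfl⟩
  obtain ⟨l, hl⟩ := hL ψ hψ
  have tendsto_commutator :
      Tendsto (fun t => waveApprox EA EB (K ∘L RB - L ∘L K) t (RB ψ)) atTop (𝓝 0) := by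
    have h := hC (RB ψ) (hEB.resolvent_apply_mem_acSubspace hdB hRB hψ)
    rw [tendsto_zero_iff_norm_tendsto_zero] at h ⊢
    simpa only [norm_waveApprox_apply] using h
  refine ⟨l + 0, (hl.add tendsto_commutator).congr fun t => ?_⟩
  simp only [waveApprox_apply, ContinuousLinearMap.comp_apply, sub_apply, map_sub,
    ← hEB.resolvent_group_apply hdB hRB, add_sub_cancel]

theorem exists_tendsto_waveApprox (hEA : IsSpectralMeasure A EA) (hEB : IsSpectralMeasure B EB)
    (hdA : Dense (A.domain : Set H₁)) (hdB : Dense (B.domain : Set H₂)) {z : ℂ}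
    {RA : H₁ →L[ℂ] H₁} {RB : H₂ →L[ℂ] H₂} (hRA : IsResolventAt A z RA)
    (hRB : IsResolventAt B z RB) {K C₂ : H₂ →L[ℂ] H₁} {G : H₀ →L[ℂ] H₁} {T : H₀ →L[ℂ] H₂}
    (hC : K ∘L RB - RA ∘L K = G ∘L T.adjoint + C₂) (hG : IsHilbertSchmidt G)
    (hT : IsHilbertSchmidt T) {M : Set H₂} (hM : M ⊆ EB.boundedDensity)
    (hM_dense : EB.boundedDensity ⊆ closure M)
    (hlim : ∀ φ ∈ M, Tendsto (fun t : ℝ => C₂ (EB.group (-t) φ)) atTop (𝓝 0))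
    (hint : ∀ φ ∈ M, IntegrableOn (fun t : ℝ => ‖C₂ (EB.group (-t) φ)‖) (Set.Ioi 0))
    {φ : H₂} (hφ : φ ∈ EB.acSubspace) :
    ∃ l, Tendsto (fun t => waveApprox EA EB K t φ) atTop (𝓝 l) := by
  have hM_ac : (EB.acSubspace : Set H₂) ⊆ closure M :=
    EB.acSubspace_subset_closure_boundedDensity.trans (closure_minimal hM_dense isClosed_closure)
  refine exists_tendsto_waveApprox_of_resolvent (L := RA) hEB hdB hRB (fun ψ hψ => ?_)
    (fun ψ hψ => ?_) hφ
  · refine exists_tendsto_of_mem_closure (norm_waveApprox_apply_le _) (fun χ hχ => ?_) (hM_ac hψ)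
    refine exists_tendsto_waveApprox_of_hasDerivAt hG hT (fun t => ?_) (hM hχ) (hlim χ hχ)
      (hint χ hχ)
    rw [← hC]
    exact hasDerivAt_waveApprox_resolvent_apply hEA hEB hdA hdB hRA hRB K χ t
  · rw [hC]
    exact tendsto_perturbation_group hT hψ <| tendsto_zero_of_mem_closure
      (W := fun t : ℝ => C₂ ∘L EB.group (-t)) (fun t => norm_apply_group_le EB C₂ (-t)) hlim
      (hM_ac hψ)

end WaveOperator

end Scattering

end

theorem mainTheorem5_general {H₀ H₁ H₂ : Type*} [NormedAddCommGroup H₀] [InnerProductSpace ℂ H₀]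
    [CompleteSpace H₀] [NormedAddCommGroup H₁] [InnerProductSpace ℂ H₁] [CompleteSpace H₁]
    [NormedAddCommGroup H₂] [InnerProductSpace ℂ H₂] [CompleteSpace H₂]
    (A : H₁ →ₗ.[ℂ] H₁) (B : H₂ →ₗ.[ℂ] H₂) (hA : IsSelfAdjoint A) (hB : IsSelfAdjoint B)
    (K : H₂ →L[ℂ] H₁) (z : ℂ)
    (hzA : z ∈ Scattering.resolventSet A) (hzB : z ∈ Scattering.resolventSet B)
    (G : H₀ →L[ℂ] H₁) (T : H₀ →L[ℂ] H₂) (C₂ : H₂ →L[ℂ] H₁)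
    (hC : K ∘L Scattering.resolvent B z - Scattering.resolvent A z ∘L K = G ∘L T.adjoint + C₂)
    (hG : Scattering.IsHilbertSchmidt G) (hT : Scattering.IsHilbertSchmidt T)
    (M : Set H₂) (hM : M ⊆ Scattering.boundedDensitySet B)
    (hM_dense : Scattering.boundedDensitySet B ⊆ closure M)
    (hlim : ∀ φ ∈ M, Tendsto (fun t : ℝ => C₂ (Scattering.expI B (-t) φ)) atTop (𝓝 0))
    (hint : ∀ φ ∈ M,
      IntegrableOn (fun t : ℝ => ‖C₂ (Scattering.expI B (-t) φ)‖) (Set.Ioi 0) volume) :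
    ∃ Ω : H₂ →L[ℂ] H₁, ∀ φ : H₂,
      Tendsto (fun t : ℝ => Scattering.expI A t (K (Scattering.expI B (-t) (Scattering.Pac B φ))))
        atTop (𝓝 (Ω φ)) := by
  have exists_limit (φ : H₂) := Scattering.exists_tendsto_waveApprox
    (Scattering.isSpectralMeasure_spectralMeasure hA hzA)
    (Scattering.isSpectralMeasure_spectralMeasure hB hzB) hA.dense_domain hB.dense_domain
    (Scattering.isResolventAt_resolvent hzA) (Scattering.isResolventAt_resolvent hzB)
    hC hG hT hM hM_dense hlim hint ((Scattering.spectralMeasure B).acProj_apply_mem φ)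
  choose Ω hΩ using exists_limit
  exact ⟨continuousLinearMapOfTendsto (fun t : ℝ => Scattering.expI A t ∘L K ∘L
    Scattering.expI B (-t) ∘L Scattering.Pac B) (f := Ω) (tendsto_pi_nhds.2 hΩ), hΩ⟩

theorem mainTheorem5 {H : Type*} [NormedAddCommGroup H] [InnerProductSpace ℂ H] [CompleteSpace H]
    (A B : H →ₗ.[ℂ] H) (hA : IsSelfAdjoint A) (hB : IsSelfAdjoint B)
    (K : H →L[ℂ] H) (z : ℂ)
    (hzA : z ∈ Scattering.resolventSet A) (hzB : z ∈ Scattering.resolventSet B)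
    (C₁ C₂ : H →L[ℂ] H)
    (hC : K ∘L Scattering.resolvent B z - Scattering.resolvent A z ∘L K = C₁ + C₂)
    (hC₁ : Scattering.IsTraceClass C₁)
    (M : Set H) (hM : M ⊆ Scattering.boundedDensitySet B)
    (hM_dense : Scattering.boundedDensitySet B ⊆ closure M)
    (hlim : ∀ φ ∈ M, Tendsto (fun t : ℝ => C₂ (Scattering.expI B (-t) φ)) atTop (𝓝 0))
    (hint : ∀ φ ∈ M,
      IntegrableOn (fun t : ℝ => ‖C₂ (Scattering.expI B (-t) φ)‖) (Set.Ioi 0) volume) :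
    ∃ Ω : H →L[ℂ] H, ∀ φ : H,
      Tendsto (fun t : ℝ => Scattering.expI A t (K (Scattering.expI B (-t) (Scattering.Pac B φ))))
        atTop (𝓝 (Ω φ)) := by
  obtain ⟨G, T, hG, hT, rfl⟩ := hC₁.exists_eq_comp_adjoint
  exact mainTheorem5_general A B hA hB K z hzA hzB G T C₂ hC hG hT M hM hM_dense hlim hint
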